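/- Let $\langle p,q\rangle=p_1\bar q_1+p_2\bar q_2-p_3\bar q_3$ on $\mathbb C^3$, let $\mathbb H^2_{\mathbb C}=\{(p_1,p_2)\in\mathbb C^2:|p_1|^2+|p_2|^2<1\}$ with the Bergman distance $\rho$ given by $\cosh^2\frac{\rho(p,q)}2=\frac{\langle \mathbf p,\mathbf q\rangle\langle \mathbf q,\mathbf p\rangle}{\langle \mathbf p,\mathbf p\rangle\langle \mathbf q,\mathbf q\rangle}$, where $\mathbf p=(p_1,p_2,1)$ and $\mathbf q=(q_1,q_2,1)$, and let $\mathrm{PU}(2,1)$, the quotient of $\mathrm{SU}(2,1)$ by its scalar matrices, act on $\mathbb H^2_{\mathbb C}$ by projective transformations. A complex line is a non-empty intersection of $\mathbb H^2_{\mathbb C}$ with a one-dimensional complex affine subspace of $\mathbb C^2$. A $\mathbb C$-Fuchsian group is a pair $(\Gamma_0,L)$ of a torsion-free discrete subgroup $\Gamma_0<\mathrm{PU}(2,1)$ and a complex line $L$ that $\Gamma_0$ leaves invariant. For $z\in L$ let $\mathrm{inj}(z)\in(0,\infty]$ be the injectivity radius of the surface $L/\Gamma_0$ at the projection of $z$ (it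 is $\infty$ if $\Gamma_0$ is trivial). Put $s(x)=2\,\mathrm{arcsinh}\bigl(1/\sinh\frac x2\bigr)$ for $0<x<\infty$ and $s(\infty)=0$. An orthogeodesic between two complex lines is a geodesic segment from a point of the first to a point of the second that is perpendicular to both lines at its endpoints. Theorem D. Let $(\Gamma_1,L_1)$ and $(\Gamma_2,L_2)$ be $\mathbb C$-Fuchsian groups such that $L_1$ and $L_2$ are disjoint, and let $p_1\in L_1$ and $p_2\in L_2$ be the endpoints of the orthogeodesic from $L_1$ to $L_2$. Suppose that $$s(\mathrm{inj}(p_1))+s(\mathrm{inj}(p_2))<\rho(L_1,L_2),$$ where $\rho(L_1,L_2)$ is the infimum of the distances between points of $L_1$ and points of $L_2$. Then $\Gamma=\langle\Gamma_1,\Gamma_2\rangle$ is a discrete, torsion-free subgroup of $\mathrm{PU}(2,1)$, so that $X=\mathbb H^2_{\mathbb C}/\Gamma$ is a complex hyperbolic $2$-manifold, and: 1. $\Gamma$ is the free product $\Gamma_1*\Gamma_2$, through an isomorphism $\Gamma_1*\Gamma_2\to\Gamma$ that restricts to the inclusions of $\Gamma_1$ and $\Gamma_2$; 2. for $k=1,2$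 the natural map $L_k/\Gamma_k\to X$ is an embedding, and its image $S_k$ is not asymptotic to itself: any two distinct translates of $L_k$ under $\Gamma$ have disjoint closures in the closed unit ball of $\mathbb C^2$; 3. $\rho_X(S_1,S_2)=\rho(L_1,L_2)$, where $\rho_X$ is the distance of $X$ (the infimum of the distances between lifts) and $\rho_X(S_1,S_2)$ is the infimum of the distances between points of $S_1$ and points of $S_2$. -/

import Mathlib

open scoped ENNReal

noncomputable section

namespace CHyp

/-! ### The Hermitian form of signature (2,1) and the ball model -/

/-- The first Hermitian form on `ℂ³`: `⟨p, q⟩ = p₁ q̄₁ + p₂ q̄₂ - p₃ q̄₃`. -/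
def herm (p q : Fin 3 → ℂ) : ℂ :=
  p 0 * star (q 0) + p 1 * star (q 1) - p 2 * star (q 2)

/-- The ball model of the complex hyperbolic plane, with the topology induced from `ℂ²`. -/
abbrev H2 : Type := {p : ℂ × ℂ // ‖p.1‖ ^ 2 + ‖p.2‖ ^ 2 < 1}

/-- The standard lift `(p₁, p₂, 1)` of a point of the ball. -/
def lift (p : H2) : Fin 3 → ℂ := ![p.1.1, p.1.2, 1]

/-- The Bergman distance: `cosh² (ρ(p,q)/2) = ⟨p,q⟩⟨q,p⟩ / (⟨p,p⟩⟨q,q⟩)`. -/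
def rho (p q : H2) : ℝ :=
  2 * Real.arcosh (Real.sqrt
    ((herm (lift p) (lift q) * herm (lift q) (lift p)) /
      (herm (lift p) (lift p) * herm (lift q) (lift q))).re)

/-- The Bergman metric tensor at `p` (the Riemannian metric whose distance is `rho`), on tangent
vectors `v, w ∈ ℂ² = T_p H2`. -/
def bergman (p : H2) (v w : ℂ × ℂ) : ℝ :=
  -4 * ((herm (lift p) (lift p) * herm ![v.1, v.2, 0] ![w.1, w.2, 0]
      - herm ![v.1, v.2, 0] (lift p) * herm (lift p) ![w.1, w.2, 0])
    / (herm (lift p) (lift p)) ^ 2).re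

/-! ### The groups SU(2,1) and PU(2,1) and the action on the ball -/

/-- `SU(2,1)`: complex matrices of determinant one that preserve the Hermitian form. -/
def SU21 : Subgroup (Matrix.SpecialLinearGroup (Fin 3) ℂ) where
  carrier := {g | ∀ p q : Fin 3 → ℂ, herm (g.1.mulVec p) (g.1.mulVec q) = herm p q}
  one_mem' := by
    intro p q
    simp
  mul_mem' := by
    intro a b ha hb p q
    have h : ∀ x : Fin 3 → ℂ, (a * b).1.mulVec x = a.1.mulVec (b.1.mulVec x) := by
      intro x
      rw [Matrix.mulVec_mulVec]
      rfl
    rw [h, h, ha, hb]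
  inv_mem' := by
    intro a ha p q
    have h : ∀ x : Fin 3 → ℂ, a.1.mulVec ((a⁻¹).1.mulVec x) = x := by
      intro x
      rw [Matrix.mulVec_mulVec]
      have : a.1 * (a⁻¹).1 = 1 := congrArg Subtype.val (mul_inv_cancel a)
      rw [this, Matrix.one_mulVec]
    rw [← ha, h, h]

/-- The scalar matrices in `SU(2,1)`, that is `{I, ωI, ω²I}` with `ω` a primitive cube root of
unity. -/
def scalars : Subgroup SU21 where
  carrier := {g | ∃ c : ℂ, ∀ x : Fin 3 → ℂ, g.1.1.mulVec x = c • x}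
  one_mem' := ⟨1, by intro x; simp⟩
  mul_mem' := by
    rintro a b ⟨c, hc⟩ ⟨d, hd⟩
    refine ⟨c * d, fun x => ?_⟩
    have h : (a * b).1.1.mulVec x = a.1.1.mulVec (b.1.1.mulVec x) := by
      rw [Matrix.mulVec_mulVec]
      rfl
    rw [h, hd, hc, smul_smul]
  inv_mem' := by
    rintro a ⟨c, hc⟩
    have h : ∀ x : Fin 3 → ℂ, a.1.1.mulVec ((a⁻¹).1.1.mulVec x) = x := by
      intro x
      rw [Matrix.mulVec_mulVec]
      have : a.1.1 * (a⁻¹).1.1 = 1 :=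
        congrArg (fun g : SU21 => g.1.1) (mul_inv_cancel a)
      rw [this, Matrix.one_mulVec]
    have hc0 : c ≠ 0 := by
      rintro rfl
      have h1 := h (fun _ => 1)
      rw [hc] at h1
      have := congrFun h1 0
      simp at this
    refine ⟨c⁻¹, fun x => ?_⟩
    have h1 := h x
    rw [hc] at h1
    rw [eq_inv_smul_iff₀ hc0]
    exact h1

instance scalars_normal : scalars.Normal where
  conj_mem := by
    rintro a ⟨c, hc⟩ g
    refine ⟨c, fun x => ?_⟩
    have h : (g * a * g⁻¹).1.1.mulVec x
        = g.1.1.mulVec (a.1.1.mulVec ((g⁻¹).1.1.mulVec x)) := by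
      rw [Matrix.mulVec_mulVec, Matrix.mulVec_mulVec]
      rfl
    have h2 : g.1.1.mulVec ((g⁻¹).1.1.mulVec x) = x := by
      rw [Matrix.mulVec_mulVec]
      have : g.1.1 * (g⁻¹).1.1 = 1 :=
        congrArg (fun g : SU21 => g.1.1) (mul_inv_cancel g)
      rw [this, Matrix.one_mulVec]
    rw [h, hc, Matrix.mulVec_smul, h2]

/-- `PU(2,1) = SU(2,1) / {I, ωI, ω²I}`, with the quotient topology. -/
abbrev PU21 : Type := SU21 ⧸ scalars

theorem herm_self_re (v : Fin 3 → ℂ) :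
    (herm v v).re = ‖v 0‖ ^ 2 + ‖v 1‖ ^ 2 - ‖v 2‖ ^ 2 := by
  have h : ∀ z : ℂ, (z * star z).re = ‖z‖ ^ 2 := by
    intro z
    rw [← Complex.normSq_eq_norm_sq]
    simp [Complex.normSq_apply]
  simp only [herm, Complex.add_re, Complex.sub_re, h]

theorem herm_lift_neg (p : H2) : (herm (lift p) (lift p)).re < 0 := by
  rw [herm_self_re]
  have := p.2
  simp [lift]
  linarith

theorem ne_zero_of_neg {v : Fin 3 → ℂ} (hv : (herm v v).re < 0) : v 2 ≠ 0 := by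
  intro h
  rw [herm_self_re, h] at hv
  simp at hv
  nlinarith [sq_nonneg ‖v 0‖, sq_nonneg ‖v 1‖]

/-- The point of the ball represented by a negative vector of `ℂ³`. -/
def proj (v : Fin 3 → ℂ) (hv : (herm v v).re < 0) : H2 :=
  ⟨(v 0 / v 2, v 1 / v 2), by
    have h2 : 0 < ‖v 2‖ ^ 2 := by
      have := ne_zero_of_neg hv
      positivity
    rw [herm_self_re] at hv
    simp only [norm_div, div_pow]
    rw [← add_div, div_lt_one h2]
    linarith⟩

theorem lift_proj (v : Fin 3 → ℂ) (hv : (herm v v).re < 0) :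
    lift (proj v hv) = (v 2)⁻¹ • v := by
  have h := ne_zero_of_neg hv
  funext i
  fin_cases i <;> simp [lift, proj, h, div_eq_inv_mul]

theorem proj_eq {v w : Fin 3 → ℂ} (hv : (herm v v).re < 0) (hw : (herm w w).re < 0)
    (c : ℂ) (h : v = c • w) : proj v hv = proj w hw := by
  have hv2 := ne_zero_of_neg hv
  have hc : c ≠ 0 := by
    rintro rfl
    simp [h] at hv2
  apply Subtype.ext
  subst h
  simp [proj, mul_div_mul_left _ _ hc]

theorem proj_lift (p : H2) : proj (lift p) (herm_lift_neg p) = p := by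
  apply Subtype.ext
  simp [proj, lift]

theorem mulVec_neg (g : SU21) (p : H2) :
    (herm (g.1.1.mulVec (lift p)) (g.1.1.mulVec (lift p))).re < 0 := by
  rw [g.2]
  exact herm_lift_neg p

/-- `SU(2,1)` acts on the ball by projective transformations. -/
instance actionSU : MulAction SU21 H2 where
  smul g p := proj (g.1.1.mulVec (lift p)) (mulVec_neg g p)
  one_smul p := by
    change proj _ _ = p
    conv_rhs => rw [← proj_lift p]
    apply proj_eq _ _ 1
    simp
  mul_smul a b p := by
    change proj _ _ = proj (a.1.1.mulVec (lift (proj _ _))) _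
    symm
    apply proj_eq _ _ (((b.1.1.mulVec (lift p)) 2)⁻¹)
    rw [lift_proj, Matrix.mulVec_smul, Matrix.mulVec_mulVec]
    rfl

theorem scalars_act_trivially : scalars ≤ (MulAction.toPermHom SU21 H2).ker := by
  rintro g ⟨c, hc⟩
  rw [MonoidHom.mem_ker]
  ext1 p
  change proj (g.1.1.mulVec (lift p)) (mulVec_neg g p) = p
  conv_rhs => rw [← proj_lift p]
  exact proj_eq _ _ c (hc _)

/-- The induced action of `PU(2,1)` on the ball. -/
instance actionPU : MulAction PU21 H2 :=
  MulAction.compHom H2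
    (QuotientGroup.lift scalars (MulAction.toPermHom SU21 H2) scalars_act_trivially)

theorem mk_smul (g : SU21) (p : H2) :
    ((g : PU21) • p : H2) = proj (g.1.1.mulVec (lift p)) (mulVec_neg g p) := rfl

/-! ### Complex lines and orthogeodesics -/

/-- A complex line of the ball: the points whose lifts are orthogonal to a positive (polar)
vector. -/
def IsComplexLine (L : Set H2) : Prop :=
  ∃ n : Fin 3 → ℂ, 0 < (herm n n).re ∧ L = {p | herm (lift p) n = 0}

/-- Infimum of the distances between the points of two sets. -/
def setDist {α : Type*} (d : α → α → ℝ) (A B : Set α) : ℝ := sInf (Set.image2 d A B)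

/-- The curve `δ` on `[0, ℓ]` is a unit speed (minimizing) geodesic segment. -/
def IsGeodesicSegment (ℓ : ℝ) (δ : ℝ → H2) : Prop :=
  ∀ s ∈ Set.Icc 0 ℓ, ∀ t ∈ Set.Icc 0 ℓ, rho (δ s) (δ t) = |s - t|

/-- The velocity of `δ : [0, ℓ] → H2` at time `t` is perpendicular, for the Bergman metric, to
the tangent vectors of `L` at `δ t`. -/
def PerpAt (ℓ : ℝ) (δ : ℝ → H2) (t : ℝ) (L : Set H2) : Prop :=
  ∃ v : ℂ × ℂ, HasDerivWithinAt (fun s => (δ s : ℂ × ℂ)) v (Set.Icc 0 ℓ) t ∧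
    ∀ w ∈ tangentConeAt ℝ ((fun x : H2 => (x : ℂ × ℂ)) '' L) (δ t : ℂ × ℂ),
      bergman (δ t) v w = 0

/-- `p₁ ∈ L₁` and `p₂ ∈ L₂` are the endpoints of an orthogeodesic from `L₁` to `L₂`: a geodesic
segment from `p₁` to `p₂` that is perpendicular to `L₁` at `p₁` and to `L₂` at `p₂`. -/
def IsOrthogeodesicEndpoints (L₁ L₂ : Set H2) (p₁ p₂ : H2) : Prop :=
  p₁ ∈ L₁ ∧ p₂ ∈ L₂ ∧ ∃ (ℓ : ℝ) (δ : ℝ → H2), 0 < ℓ ∧ δ 0 = p₁ ∧ δ ℓ = p₂ ∧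
    IsGeodesicSegment ℓ δ ∧ PerpAt ℓ δ 0 L₁ ∧ PerpAt ℓ δ ℓ L₂

/-! ### Discrete groups, quotients, and complex geodesic surfaces -/

/-- `Γ` is a discrete torsion-free subgroup of `PU(2,1)`, i.e. `H2 / Γ` is a complex hyperbolic
`2`-manifold. -/
structure IsDiscreteTorsionFree (Γ : Subgroup PU21) : Prop where
  discrete : DiscreteTopology Γ
  torsionFree : ∀ g ∈ Γ, IsOfFinOrder g → g = 1

/-- `(Γ, L)` is a `ℂ`-Fuchsian group. -/
structure IsCFuchsian (Γ : Subgroup PU21) (L : Set H2) : Prop where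
  group : IsDiscreteTorsionFree Γ
  line : IsComplexLine L
  invariant : ∀ g ∈ Γ, (fun x => g • x) '' L = L

/-- The quotient `H2 / Γ`, with the quotient topology. -/
abbrev QuotH2 (Γ : Subgroup PU21) : Type := Quotient (MulAction.orbitRel Γ H2)

/-- The quotient `L / Γ` (points of `L` up to the action of `Γ`), with the quotient topology. -/
abbrev Surf (Γ : Subgroup PU21) (L : Set H2) : Type :=
  Quotient ((MulAction.orbitRel Γ H2).comap (Subtype.val : L → H2))

/-- The projection `L → L / Γ`. -/
def surfProj (Γ : Subgroup PU21) (L : Set H2) (x : L) : Surf Γ L := Quotient.mk _ x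

/-- The injectivity radius of `L / Γ` at the projection of `z`: the supremum of the radii `r` such
that the disc of radius `r` about `z` in `L` injects into `L / Γ`. It is `∞` when `Γ` is trivial. -/
def inj (Γ : Subgroup PU21) (L : Set H2) (z : H2) : ℝ≥0∞ :=
  ⨆ (r : ℝ) (_ : Set.InjOn (surfProj Γ L) {x | rho z x < r}), ENNReal.ofReal r

/-- `s(x) = 2 arcsinh (1 / sinh (x/2))` for `0 < x < ∞`, extended by its limits `s(0) = ∞` and
`s(∞) = 0`. -/
def sFun (x : ℝ≥0∞) : ℝ≥0∞ :=
  if x = 0 then ⊤ else if x = ⊤ then 0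
  else ENNReal.ofReal (2 * Real.arsinh (1 / Real.sinh (x.toReal / 2)))

/-- The distance of `H2 / Γ`: the infimum of the distances between lifts. -/
def rhoQuot (Γ : Subgroup PU21) (a b : QuotH2 Γ) : ℝ :=
  setDist rho {x | (Quotient.mk _ x : QuotH2 Γ) = a} {y | (Quotient.mk _ y : QuotH2 Γ) = b}

/-- The natural map `L / Γ₀ → H2 / Γ` for a subgroup `Γ₀` of `Γ`. -/
def surfMap {Γ₀ Γ : Subgroup PU21} (h : Γ₀ ≤ Γ) (L : Set H2) : Surf Γ₀ L → QuotH2 Γ :=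
  Quotient.lift (fun x : L => (Quotient.mk _ x.1 : QuotH2 Γ)) (by
    rintro x y ⟨g, hg⟩
    exact Quotient.sound ⟨⟨g.1, h g.2⟩, hg⟩)

/-- `L / Γ₀` is an embedded complex geodesic surface in `H2 / Γ`: the natural map, which is locally
the inclusion of the complex line `L` in `H2`, is an embedding; and the surface is not asymptotic
to itself, i.e. two distinct lifts of it do not meet in the closed ball. -/
structure IsEmbeddedSurface {Γ₀ Γ : Subgroup PU21} (h : Γ₀ ≤ Γ) (L : Set H2) : Prop where
  embedding : Topology.IsEmbedding (surfMap h L)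
  notAsymptotic : ∀ g ∈ Γ, (fun x => g • x) '' L ≠ L →
    Disjoint (closure ((fun x : H2 => (x : ℂ × ℂ)) '' ((fun x => g • x) '' L)))
      (closure ((fun x : H2 => (x : ℂ × ℂ)) '' L))

end CHyp

end

/-! The proof is a quantitative ping-pong. Let `c` be polar to the complex line `C` through `p₁` and
`p₂`. Perpendicularity of the orthogeodesic makes `C` orthogonal to both `L₁` and `L₂`, so there are
orthonormal frames `(c, n₁, P₁)` and `(c, n₂, P₂)` with `nₖ` polar to `Lₖ` and `Pₖ` a lift of `pₖ`;
they differ by a boost of half the length of the orthogeodesic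
(`IsOrthogeodesicEndpoints.exists_frames`).

If the orthogonal projections of a point to `Lₖ` and to `C` lie at distances `a` and `b` from `pₖ`,
negativity of its lift says exactly that `sinh (a/2) * sinh (b/2) < 1`. Hence `a ≥ inj pₖ` forces `b
< s (inj pₖ)`; this is where `s` comes from (`LineFrame.axisDist_lt_of_mem_outer`).

Let `Aₖ` be the set of points whose projection to `Lₖ` is at distance at least `inj pₖ` from `pₖ`.
Projection to `Lₖ` commutes with `Γₖ`, and nontrivial elements of `Γₖ` map the open disc of radius
`inj pₖ` off itself, so they map the complement of `Aₖ` into `Aₖ`. Let `θₖ` be the distance within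
`C` from `pₖ` to the projection to `C`. Then `θₖ < s (inj pₖ)` on `Aₖ`, while `θ₁ + θ₂ ≥ ρ(p₁, p₂) ≥
ρ(L₁, L₂)` everywhere by the triangle inequality in `C`. The hypothesis therefore makes `A₁` and
`A₂` disjoint, with room to spare.

Ping-pong gives the free product and discreteness; torsion-freeness is then a fact about free
products. Since `θₖ` is a lower bound for the distance to `Lₖ`, the spare room separates distinct
translates of a line uniformly (`PingPong.separated_same`), which gives embeddedness and disjoint
closures. For translates of the two different lines, a geodesic joining them meets both of the sets
played by the connecting word, and this makes it longer than `ρ(p₁, p₂)` (`PingPong.separated_ne`).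
-/

namespace Monoid.CoprodI

/-! ### Reduced words and torsion in free products. -/

variable {ι : Type*} {G : ι → Type*} [∀ i, Group (G i)]

theorem NeWord.prod_ne_one {i j : ι} (w : NeWord G i j) : w.prod ≠ 1 := by
  classical
  intro h
  have h1 : w.toWord = Word.empty := by
    apply Word.equiv.symm.injective
    exact h
  exact w.toList_ne_nil (congrArg Word.toList h1)

theorem eq_one_or_exists_neWord (x : CoprodI G) :
    x = 1 ∨ ∃ (i j : ι) (w : NeWord G i j), w.prod = x := by
  classical
  by_cases h : Word.equiv x = Word.empty
  · left
    rw [← Word.equiv.symm_apply_apply x, h]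
    rfl
  · right
    obtain ⟨i, j, w, hw⟩ := NeWord.of_word _ h
    refine ⟨i, j, w, ?_⟩
    rw [← Word.equiv.symm_apply_apply x, ← hw]
    rfl

/-- Splitting off the first letter of a nonempty reduced word. -/
theorem NeWord.exists_head {i j : ι} (w : NeWord G i j) :
    ∃ h : G i, (i = j ∧ w.prod = of h) ∨
      ∃ k, k ≠ i ∧ ∃ w' : NeWord G k j, w.prod = of h * w'.prod := by
  induction w with
  | singleton x hx => exact ⟨x, Or.inl ⟨rfl, by simp⟩⟩
  | append w₁ hne w₂ ih₁ _ =>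
    obtain ⟨h, ⟨hij, hw⟩ | ⟨k, hk, w', hw⟩⟩ := ih₁
    · exact ⟨h, Or.inr ⟨_, fun e => hne (hij ▸ e.symm), w₂, by simp [hw]⟩⟩
    · exact ⟨h, Or.inr ⟨k, hk, append w' hne w₂, by simp [hw, mul_assoc]⟩⟩

/-- Splitting off the last letter of a nonempty reduced word. -/
theorem NeWord.exists_last {i j : ι} (w : NeWord G i j) :
    ∃ h : G j, (i = j ∧ w.prod = of h) ∨
      ∃ k, k ≠ j ∧ ∃ w' : NeWord G i k, w.prod = w'.prod * of h := by
  obtain ⟨h, ⟨hij, hw⟩ | ⟨k, hk, w', hw⟩⟩ := w.inv.exists_head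
  · exact ⟨h⁻¹, Or.inl ⟨hij.symm, by rw [map_inv, ← hw, inv_prod, inv_inv]⟩⟩
  · exact ⟨h⁻¹, Or.inr ⟨k, hk, w'.inv, by
      rw [← inv_inv w.prod, ← inv_prod, hw]; simp⟩⟩

/-- When the end letters lie in different factors, copies of the word concatenate without
cancellation, so a cyclically reduced word has infinite order. -/
theorem NeWord.exists_pow {i j : ι} (w : NeWord G i j) (h : j ≠ i) (n : ℕ) :
    ∃ w' : NeWord G i j, w'.prod = w.prod ^ (n + 1) := by
  induction n with
  | zero => exact ⟨w, by simp⟩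
  | succ n ih =>
    obtain ⟨w', hw'⟩ := ih
    exact ⟨append w' h w, by rw [append_prod, hw', pow_succ _ (n + 1)]⟩

theorem NeWord.not_isOfFinOrder {i j : ι} (w : NeWord G i j) (h : j ≠ i) :
    ¬ IsOfFinOrder w.prod := by
  rw [isOfFinOrder_iff_pow_eq_one]
  rintro ⟨n, hn, h1⟩
  obtain ⟨m, rfl⟩ := Nat.exists_eq_succ_of_ne_zero hn.ne'
  obtain ⟨w', hw'⟩ := w.exists_pow h m
  exact w'.prod_ne_one (hw'.trans h1)

/-- Every element of a free product is trivial, conjugate into a factor, or conjugate to a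
cyclically reduced word of length at least two. -/
theorem isConj_classification (w : Word G) :
    w.prod = 1 ∨ (∃ i, ∃ g : G i, IsConj (of g) w.prod) ∨
      ∃ i j, j ≠ i ∧ ∃ v : NeWord G i j, IsConj v.prod w.prod := by
  classical
  induction hn : w.toList.length using Nat.strong_induction_on generalizing w with
  | _ n ih =>
  by_cases he : w = Word.empty
  · left; rw [he, Word.prod_empty]
  obtain ⟨i, j, v, hv⟩ := NeWord.of_word w he
  right
  by_cases hij : j = i
  swap
  · exact Or.inr ⟨i, j, hij, v, by rw [← hv]; exact IsConj.refl _⟩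
  subst hij
  have hhead := v.toList_head?
  have hlast := v.toList_getLast?
  have hl : w.toList = v.toList := by rw [← hv]; rfl
  rw [← hl] at hhead hlast
  obtain ⟨l, hne1, hchain⟩ := w
  simp only at hhead hlast hn hl
  cases l with
  | nil => simp at hhead
  | cons a m =>
  obtain rfl : a = ⟨j, v.head⟩ := by simpa using hhead
  rcases List.eq_nil_or_concat' m with rfl | ⟨m', b, rfl⟩
  · left
    exact ⟨j, v.head, isConj_iff.2 ⟨1, by simp [Word.prod]⟩⟩
  obtain rfl : b = ⟨j, v.last⟩ := by
    rw [← List.cons_append, List.getLast?_append] at hlast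
    simpa using hlast
  have hm'1 : ∀ l ∈ m', Sigma.snd l ≠ 1 := fun l hl' => hne1 l (by simp [hl'])
  have hm'c : (⟨j, v.head⟩ :: m' : List (Σ i, G i)).IsChain (fun l l' => l.1 ≠ l'.1) := by
    rw [← List.cons_append] at hchain
    exact (List.isChain_append.1 hchain).1
  -- Conjugating by the last letter moves it to the front, next to a letter of the same factor. A
  -- shorter word for the rotated product is covered by induction; if that product is trivial, it
  -- counts as the image of `1` in a factor.
  have key : ∀ u : Word G, u.toList.length < n →
      u.prod = of v.last * (of v.head * (m'.map fun l => of l.2).prod) →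
      (∃ i, ∃ g : G i, IsConj (of g) (⟨_, hne1, hchain⟩ : Word G).prod) ∨
      ∃ i j, j ≠ i ∧ ∃ v : NeWord G i j, IsConj v.prod (⟨_, hne1, hchain⟩ : Word G).prod := by
    intro u hu hup
    have hconj : IsConj u.prod (⟨_, hne1, hchain⟩ : Word G).prod := by
      rw [isConj_iff]
      refine ⟨(of v.last)⁻¹, ?_⟩
      rw [hup]
      simp [Word.prod, mul_assoc]
    rcases ih _ hu u rfl with h | ⟨i, g, h⟩ | ⟨i, k, hk, v', h⟩
    · left
      refine ⟨j, 1, ?_⟩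
      rw [map_one, ← h]
      exact hconj
    · exact Or.inl ⟨i, g, h.trans hconj⟩
    · exact Or.inr ⟨i, k, hk, v', h.trans hconj⟩
  -- The two adjacent letters either cancel or merge into one; both ways the word gets shorter.
  by_cases hone : v.last * v.head = 1
  · refine key ⟨m', hm'1, (List.isChain_cons.1 hm'c).2⟩ ?_ ?_
    · simp only [List.length_cons, List.length_append, List.length_nil] at hn ⊢; omega
    · rw [← mul_assoc, ← map_mul, hone, map_one, one_mul]; rfl
  · refine key ⟨⟨j, v.last * v.head⟩ :: m', ?_, ?_⟩ ?_ ?_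
    · rw [List.forall_mem_cons]
      exact ⟨hone, hm'1⟩
    · rw [List.isChain_cons] at hm'c ⊢
      exact hm'c
    · simp only [List.length_cons, List.length_append, List.length_nil] at hn ⊢; omega
    · simp [Word.prod, mul_assoc]

/-- A free product of torsion-free groups is torsion-free. -/
theorem eq_one_of_isOfFinOrder (hG : ∀ i, ∀ g : G i, IsOfFinOrder g → g = 1) (x : CoprodI G)
    (hx : IsOfFinOrder x) : x = 1 := by
  classical
  have hprod : (Word.equiv x).prod = x := Word.equiv.symm_apply_apply x
  have hconj : ∀ y, IsConj y (Word.equiv x).prod → IsOfFinOrder y := by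
    intro y hy
    rw [hprod] at hy
    obtain ⟨c, rfl⟩ := isConj_iff.1 hy
    simpa [mul_assoc] using (MulAut.conj c⁻¹).toMonoidHom.isOfFinOrder hx
  rcases isConj_classification (Word.equiv x) with h | ⟨i, g, h⟩ | ⟨i, j, hij, v, h⟩
  · rwa [hprod] at h
  · have h1 := hG i g ((of_injective i).isOfFinOrder_iff.1 (hconj _ h))
    rw [h1, map_one, hprod] at h
    exact (isConj_one_right.1 h)
  · exact absurd (hconj _ h) (v.not_isOfFinOrder hij)

/-! ### Normal forms in a free product of two groups. -/

section Bool

variable {H : Bool → Type*} [∀ i, Group (H i)]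

/-- An element of a free product of two groups lies in the factor `b`, or is a reduced word with
first and last letters in the other factor, up to multiplication by elements of the factor `b`. -/
theorem exists_mul_neWord_mul_same (b : Bool) (x : CoprodI H) :
    (∃ g : H b, x = of g) ∨
      ∃ (g h : H b) (w : NeWord H (!b) (!b)), x = of g * w.prod * of h := by
  have right : ∀ {i : Bool} (j : Bool) (w : NeWord H i j), i = !b →
      ∃ (h : H b) (w' : NeWord H (!b) (!b)), w.prod = w'.prod * of h := by
    rintro _ j w rfl
    by_cases hj : j = b
    · subst hj
      obtain ⟨h, ⟨e, _⟩ | ⟨k, hk, w', hw⟩⟩ := w.exists_last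
      · simp at e
      · obtain rfl : k = !j := by simpa [Bool.eq_not_iff] using hk
        exact ⟨h, w', hw⟩
    · obtain rfl : j = !b := by simpa [Bool.eq_not_iff] using hj
      exact ⟨1, w, by simp⟩
  rcases eq_one_or_exists_neWord x with rfl | ⟨i, j, w, rfl⟩
  · exact Or.inl ⟨1, by simp⟩
  by_cases hi : i = b
  · subst hi
    obtain ⟨g, ⟨_, hw⟩ | ⟨k, hk, w', hw⟩⟩ := w.exists_head
    · exact Or.inl ⟨g, hw⟩
    · obtain ⟨h, w'', hw'⟩ := right j w' (by simpa [Bool.eq_not_iff] using hk)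
      exact Or.inr ⟨g, h, w'', by rw [hw, hw', mul_assoc]⟩
  · obtain ⟨h, w'', hw'⟩ := right j w (by simpa [Bool.eq_not_iff] using hi)
    exact Or.inr ⟨1, h, w'', by rw [hw', map_one, one_mul]⟩

/-- An element of a free product of two groups is, up to multiplication on the left by the factor
`b` and on the right by the other factor, trivial or a reduced word with first letter in the other
factor and last letter in the factor `b`. -/
theorem exists_mul_neWord_mul_ne (b : Bool) (x : CoprodI H) :
    (∃ (g : H b) (h : H (!b)), x = of g * of h) ∨
      ∃ (g : H b) (h : H (!b)) (w : NeWord H (!b) b), x = of g * w.prod * of h := by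
  have right : ∀ {i : Bool} (j : Bool) (w : NeWord H i j), i = !b →
      (∃ h : H (!b), w.prod = of h) ∨
      ∃ (h : H (!b)) (w' : NeWord H (!b) b), w.prod = w'.prod * of h := by
    rintro _ j w rfl
    by_cases hj : j = b
    · subst hj
      exact Or.inr ⟨1, w, by simp⟩
    · obtain rfl : j = !b := by simpa [Bool.eq_not_iff] using hj
      obtain ⟨h, ⟨_, hw⟩ | ⟨k, hk, w', hw⟩⟩ := w.exists_last
      · exact Or.inl ⟨h, hw⟩
      · obtain rfl : k = b := by simpa [Bool.eq_not_iff] using hk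
        exact Or.inr ⟨h, w', hw⟩
  rcases eq_one_or_exists_neWord x with rfl | ⟨i, j, w, rfl⟩
  · exact Or.inl ⟨1, 1, by simp⟩
  by_cases hi : i = b
  · subst hi
    obtain ⟨g, ⟨_, hw⟩ | ⟨k, hk, w', hw⟩⟩ := w.exists_head
    · exact Or.inl ⟨g, 1, by simp [hw]⟩
    · rcases right j w' (by simpa [Bool.eq_not_iff] using hk) with ⟨h, hw'⟩ | ⟨h, w'', hw'⟩
      · exact Or.inl ⟨g, h, by rw [hw, hw']⟩
      · exact Or.inr ⟨g, h, w'', by rw [hw, hw', mul_assoc]⟩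
  · rcases right j w (by simpa [Bool.eq_not_iff] using hi) with ⟨h, hw'⟩ | ⟨h, w'', hw'⟩
    · exact Or.inl ⟨1, h, by rw [hw', map_one, one_mul]⟩
    · exact Or.inr ⟨1, h, w'', by rw [hw', map_one, one_mul]⟩

/-- The free product of a family indexed by `Bool` is the binary free product. -/
def boolEquiv (H : Bool → Type*) [∀ i, Group (H i)] :
    Monoid.Coprod (H true) (H false) ≃* CoprodI H :=
  MonoidHom.toMulEquiv
    (Coprod.lift (of (i := true)) (of (i := false)))
    (lift fun b => match b with
      | true => Coprod.inl
      | false => Coprod.inr)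
    (by ext <;> simp)
    (by ext i x; cases i <;> simp)

end Bool

end Monoid.CoprodI

namespace CHyp

/-! ### Algebra of the Hermitian form -/

section Herm

variable (u v w : Fin 3 → ℂ) (c : ℂ)

theorem herm_add_left : herm (u + v) w = herm u w + herm v w := by
  simp only [herm, Pi.add_apply]; ring

theorem herm_add_right : herm u (v + w) = herm u v + herm u w := by
  simp only [herm, Pi.add_apply, star_add]; ring

theorem herm_sub_left : herm (u - v) w = herm u w - herm v w := by
  simp only [herm, Pi.sub_apply]; ring

theorem herm_sub_right : herm u (v - w) = herm u v - herm u w := by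
  simp only [herm, Pi.sub_apply, star_sub]; ring

theorem herm_smul_left : herm (c • v) w = c * herm v w := by
  simp only [herm, Pi.smul_apply, smul_eq_mul]; ring

theorem herm_smul_right : herm v (c • w) = star c * herm v w := by
  simp only [herm, Pi.smul_apply, smul_eq_mul, star_mul]; ring

theorem star_herm : star (herm v w) = herm w v := by
  simp only [herm, star_add, star_sub, star_mul, star_star]

theorem herm_self : herm v v = ((herm v v).re : ℂ) := by
  apply Complex.ext
  · simp
  · have h := congrArg Complex.im (star_herm v v)
    simp only [Complex.star_def, Complex.conj_im] at h
    simp only [Complex.ofReal_im]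
    linarith

theorem herm_mul_herm : herm v w * herm w v = (Complex.normSq (herm v w) : ℂ) := by
  rw [← star_herm v w, Complex.star_def, Complex.mul_conj]

theorem normSq_herm_comm : Complex.normSq (herm v w) = Complex.normSq (herm w v) := by
  rw [← star_herm v w, Complex.star_def, Complex.normSq_conj]

theorem herm_smul_self_re : (herm (c • v) (c • v)).re = Complex.normSq c * (herm v v).re := by
  rw [herm_smul_left, herm_smul_right, ← mul_assoc, Complex.star_def, Complex.mul_conj,
    Complex.re_ofReal_mul]

variable {u v w}

theorem herm_eq_zero_comm : herm v w = 0 ↔ herm w v = 0 := by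
  rw [← star_herm v w, star_eq_zero]

theorem herm_self_re_normSq (v : Fin 3 → ℂ) : (herm v v).re =
    Complex.normSq (v 0) + Complex.normSq (v 1) - Complex.normSq (v 2) := by
  rw [herm_self_re, Complex.normSq_eq_norm_sq, Complex.normSq_eq_norm_sq,
    Complex.normSq_eq_norm_sq]

/-- The form is positive semidefinite on the orthogonal complement of a negative vector. -/
theorem herm_self_nonneg_of_orthogonal (hv : (herm v v).re < 0) (h : herm u v = 0) :
    0 ≤ (herm u u).re := by
  have h0 : u 2 * star (v 2) = u 0 * star (v 0) + u 1 * star (v 1) := by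
    simp only [herm] at h
    linear_combination -h
  -- Lagrange's identity for the first two coordinates. If both vectors were negative, the left side
  -- would exceed the right.
  have h1 : Complex.normSq (u 2) * Complex.normSq (v 2)
      + Complex.normSq (u 0 * v 1 - u 1 * v 0)
      = (Complex.normSq (u 0) + Complex.normSq (u 1))
        * (Complex.normSq (v 0) + Complex.normSq (v 1)) := by
    have h2 := congrArg Complex.normSq h0
    rw [map_mul, Complex.star_def, Complex.normSq_conj] at h2
    rw [h2]
    simp only [Complex.normSq_apply, Complex.add_re, Complex.add_im,
      Complex.mul_re, Complex.mul_im, Complex.sub_re, Complex.sub_im, Complex.conj_re,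
      Complex.conj_im]
    ring
  rw [herm_self_re_normSq] at hv ⊢
  have h3 := Complex.normSq_nonneg (u 0 * v 1 - u 1 * v 0)
  have h4 := Complex.normSq_nonneg (u 0)
  have h5 := Complex.normSq_nonneg (u 1)
  have h6 := Complex.normSq_nonneg (v 0)
  have h7 := Complex.normSq_nonneg (v 1)
  by_contra hneg
  nlinarith

/-- Pythagoras for the component of `w` orthogonal to `v`. It yields the reverse Cauchy-Schwarz
inequality and, for positive `v`, the projections to complex lines. -/
theorem sub_smul_herm_self_re (hv : (herm v v).re ≠ 0) :
    (herm (w - (herm w v / herm v v) • v) (w - (herm w v / herm v v) • v)).re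
      = (herm w w).re - Complex.normSq (herm w v) / (herm v v).re := by
  have hv' : herm v v ≠ 0 := fun h => hv (by rw [h]; rfl)
  have h0 : herm (w - (herm w v / herm v v) • v) v = 0 := by
    rw [herm_sub_left, herm_smul_left]
    field_simp
    ring
  rw [herm_sub_right, herm_smul_right, h0, mul_zero, sub_zero, herm_sub_left, herm_smul_left,
    Complex.sub_re, div_mul_eq_mul_div, herm_mul_herm, herm_self v, ← Complex.ofReal_div,
    Complex.ofReal_re, Complex.ofReal_re]

/-- The reverse Cauchy-Schwarz inequality for negative vectors. -/
theorem mul_le_normSq_herm (hv : (herm v v).re < 0) :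
    (herm v v).re * (herm w w).re ≤ Complex.normSq (herm v w) := by
  have hv' : herm v v ≠ 0 := fun h => by rw [h] at hv; simp at hv
  have h := herm_self_nonneg_of_orthogonal (u := w - (herm w v / herm v v) • v) hv (by
    rw [herm_sub_left, herm_smul_left]
    field_simp
    ring)
  rw [sub_smul_herm_self_re hv.ne, sub_nonneg, div_le_iff_of_neg hv] at h
  rw [normSq_herm_comm]
  linarith

end Herm

/-! ### The distance -/

/-- The quantity `⟨v,w⟩⟨w,v⟩ / (⟨v,v⟩⟨w,w⟩)`. -/
noncomputable def kappa (v w : Fin 3 → ℂ) : ℝ :=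
  Complex.normSq (herm v w) / ((herm v v).re * (herm w w).re)

theorem kappa_comm (v w : Fin 3 → ℂ) : kappa v w = kappa w v := by
  rw [kappa, kappa, normSq_herm_comm, mul_comm (herm v v).re]

theorem kappa_smul_left {c : ℂ} (hc : c ≠ 0) (v w : Fin 3 → ℂ) :
    kappa (c • v) w = kappa v w := by
  have h : Complex.normSq c ≠ 0 := by simpa using hc
  rw [kappa, kappa, herm_smul_left, herm_smul_self_re, map_mul, mul_assoc,
    mul_div_mul_left _ _ h]

theorem kappa_smul_right {c : ℂ} (hc : c ≠ 0) (v w : Fin 3 → ℂ) :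
    kappa v (c • w) = kappa v w := by
  rw [kappa_comm, kappa_smul_left hc, kappa_comm]

theorem one_le_kappa {v w : Fin 3 → ℂ} (hv : (herm v v).re < 0) (hw : (herm w w).re < 0) :
    1 ≤ kappa v w := by
  rw [kappa, one_le_div (mul_pos_of_neg_of_neg hv hw)]
  exact mul_le_normSq_herm hv

theorem rho_eq (p q : H2) : rho p q = 2 * Real.arcosh (Real.sqrt (kappa (lift p) (lift q))) := by
  rw [rho, kappa, herm_mul_herm, herm_self (lift p), herm_self (lift q), ← Complex.ofReal_mul,
    ← Complex.ofReal_div, Complex.ofReal_re, Complex.ofReal_re, Complex.ofReal_re]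

theorem one_le_sqrt_kappa (p q : H2) : 1 ≤ Real.sqrt (kappa (lift p) (lift q)) :=
  Real.one_le_sqrt.2 (one_le_kappa (herm_lift_neg p) (herm_lift_neg q))

theorem rho_nonneg (p q : H2) : 0 ≤ rho p q := by
  rw [rho_eq]
  have := Real.arcosh_nonneg (one_le_sqrt_kappa p q)
  linarith

theorem cosh_sq_half_rho (p q : H2) :
    Real.cosh (rho p q / 2) ^ 2 = kappa (lift p) (lift q) := by
  rw [rho_eq, mul_div_cancel_left₀ _ two_ne_zero, Real.cosh_arcosh (one_le_sqrt_kappa p q),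
    Real.sq_sqrt (zero_le_one.trans (one_le_kappa (herm_lift_neg p) (herm_lift_neg q)))]

theorem sinh_sq_half_rho (p q : H2) :
    Real.sinh (rho p q / 2) ^ 2 = kappa (lift p) (lift q) - 1 := by
  rw [← cosh_sq_half_rho, Real.sinh_sq]

theorem kappa_lift_proj (v w : Fin 3 → ℂ) (hv : (herm v v).re < 0) (hw : (herm w w).re < 0) :
    kappa (lift (proj v hv)) (lift (proj w hw)) = kappa v w := by
  rw [lift_proj, lift_proj, kappa_smul_left (inv_ne_zero (ne_zero_of_neg hv)),
    kappa_smul_right (inv_ne_zero (ne_zero_of_neg hw))]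

theorem rho_comm (p q : H2) : rho p q = rho q p := by
  rw [rho_eq, rho_eq, kappa_comm]

theorem rho_self (p : H2) : rho p p = 0 := by
  have h : kappa (lift p) (lift p) = 1 := by
    have h0 := (herm_lift_neg p).ne
    rw [kappa, herm_self, Complex.normSq_ofReal, Complex.ofReal_re]
    field_simp
  rw [rho_eq, h, Real.sqrt_one, Real.arcosh_zero, mul_zero]

theorem rho_smul (g : PU21) (p q : H2) : rho (g • p) (g • q) = rho p q := by
  induction g using QuotientGroup.induction_on with
  | H g =>
    rw [mk_smul, mk_smul, rho_eq, rho_eq, kappa_lift_proj, kappa, kappa, g.2, g.2, g.2]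

/-- A lower bound for the distance through its hyperbolic sine. -/
theorem le_rho_of_sinh_sq_le {t : ℝ} {p q : H2}
    (h : Real.sinh (t / 2) ^ 2 ≤ kappa (lift p) (lift q) - 1) : t ≤ rho p q := by
  rw [← sinh_sq_half_rho] at h
  have h1 : Real.sinh (t / 2) ≤ Real.sinh (rho p q / 2) :=
    le_of_sq_le_sq h (Real.sinh_nonneg_iff.2 (by linarith [rho_nonneg p q]))
  rw [Real.sinh_le_sinh] at h1
  linarith

/-! ### Continuity -/

theorem continuous_lift : Continuous lift := by
  refine continuous_pi fun i => ?_
  fin_cases i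
  · exact continuous_fst.comp continuous_subtype_val
  · exact continuous_snd.comp continuous_subtype_val
  · exact continuous_const

theorem Continuous.herm {X : Type*} [TopologicalSpace X] {f g : X → Fin 3 → ℂ}
    (hf : Continuous f) (hg : Continuous g) : Continuous fun x => herm (f x) (g x) := by
  unfold CHyp.herm
  fun_prop

theorem Continuous.proj {X : Type*} [TopologicalSpace X] {f : X → Fin 3 → ℂ}
    (hf : Continuous f) (hneg : ∀ x, (CHyp.herm (f x) (f x)).re < 0) :
    Continuous fun x => proj (f x) (hneg x) := by
  refine Continuous.subtype_mk ?_ _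
  have h2 : ∀ x, f x 2 ≠ 0 := fun x => ne_zero_of_neg (hneg x)
  exact (((continuous_apply 0).comp hf).div ((continuous_apply 2).comp hf) h2).prodMk
    (((continuous_apply 1).comp hf).div ((continuous_apply 2).comp hf) h2)

theorem Continuous.rho {X : Type*} [TopologicalSpace X] {f g : X → H2}
    (hf : Continuous f) (hg : Continuous g) : Continuous fun x => rho (f x) (g x) := by
  simp only [rho_eq]
  refine continuous_const.mul (Real.continuousOn_arcosh.comp_continuous ?_
    fun x => one_le_sqrt_kappa _ _)
  refine Real.continuous_sqrt.comp ?_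
  unfold kappa
  have hf' := continuous_lift.comp hf
  have hg' := continuous_lift.comp hg
  refine Continuous.div (Complex.continuous_normSq.comp (Continuous.herm hf' hg')) ?_ fun x => ?_
  · exact (Complex.continuous_re.comp (Continuous.herm hf' hf')).mul
      (Complex.continuous_re.comp (Continuous.herm hg' hg'))
  · exact mul_ne_zero (herm_lift_neg _).ne (herm_lift_neg _).ne

theorem continuous_smul_right (p : H2) : Continuous fun g : PU21 => g • p := by
  have h : Continuous fun g : SU21 => proj (g.1.1.mulVec (lift p)) (mulVec_neg g p) := by
    refine Continuous.proj (f := fun g : SU21 => g.1.1.mulVec (lift p)) ?_ fun g => mulVec_neg g p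
    have h1 : Continuous fun g : SU21 => g.1.1 := continuous_subtype_val.comp continuous_subtype_val
    exact h1.matrix_mulVec continuous_const
  exact (QuotientGroup.isQuotientMap_mk scalars).continuous_iff.2 h

instance : ContinuousConstSMul PU21 H2 where
  continuous_const_smul g := by
    induction g using QuotientGroup.induction_on with
    | H g =>
      refine Continuous.proj (f := fun p => g.1.1.mulVec (lift p)) ?_ fun p => mulVec_neg g p
      exact continuous_const.matrix_mulVec continuous_lift

/-! ### Geodesic segments -/

/-- A lift of `p` of norm `-1`. -/
noncomputable def unitLift (p : H2) : Fin 3 → ℂ :=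
  (((Real.sqrt (-(herm (lift p) (lift p)).re))⁻¹ : ℝ) : ℂ) • lift p

theorem unitLift_scale_ne_zero (p : H2) :
    (((Real.sqrt (-(herm (lift p) (lift p)).re))⁻¹ : ℝ) : ℂ) ≠ 0 := by
  have h := herm_lift_neg p
  have : 0 < Real.sqrt (-(herm (lift p) (lift p)).re) := Real.sqrt_pos.2 (by linarith)
  exact_mod_cast (inv_pos.2 this).ne'

theorem herm_unitLift (p : H2) : herm (unitLift p) (unitLift p) = -1 := by
  have h := herm_lift_neg p
  rw [herm_self, unitLift, herm_smul_self_re, Complex.normSq_ofReal, ← mul_inv,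
    Real.mul_self_sqrt (by linarith)]
  rw [inv_neg, neg_mul, inv_mul_cancel₀ h.ne]
  simp

theorem kappa_unitLift (p q : H2) : kappa (lift p) (lift q) =
    Complex.normSq (herm (unitLift p) (unitLift q)) := by
  have : kappa (lift p) (lift q) = kappa (unitLift p) (unitLift q) := by
    rw [unitLift, unitLift, kappa_smul_left (unitLift_scale_ne_zero p),
      kappa_smul_right (unitLift_scale_ne_zero q)]
  rw [this, kappa, herm_unitLift, herm_unitLift]
  simp

/-- The form is real on the real span of aligned lifts, which reduces computations along a geodesic
to real algebra. -/
theorem herm_real_combination {X Y : Fin 3 → ℂ} {C : ℝ} (hX : herm X X = -1) (hY : herm Y Y = -1)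
    (hXY : herm X Y = -(C : ℂ)) (s t s' t' : ℝ) :
    herm ((s : ℂ) • X + (t : ℂ) • Y) ((s' : ℂ) • X + (t' : ℂ) • Y)
      = ((-(s * s' + t * t' + (s * t' + t * s') * C) : ℝ) : ℂ) := by
  have hYX : herm Y X = -(C : ℂ) := by
    rw [← star_herm, hXY, star_neg, Complex.star_def, Complex.conj_ofReal]
  simp only [herm_add_left, herm_add_right, herm_smul_left, herm_smul_right, hX, hY, hXY, hYX,
    Complex.star_def, Complex.conj_ofReal]
  push_cast
  ring

/-- Two points have lifts of norm `-1` whose product is a negative real number. -/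
theorem exists_aligned_lifts (x y : H2) : ∃ (X Y : Fin 3 → ℂ) (a b : ℂ), a ≠ 0 ∧ b ≠ 0 ∧
    X = a • lift x ∧ Y = b • lift y ∧ herm X X = -1 ∧ herm Y Y = -1 ∧
    herm X Y = -(Real.cosh (rho x y / 2) : ℂ) := by
  set h := herm (unitLift x) (unitLift y) with hh
  have hk : Complex.normSq h = Real.cosh (rho x y / 2) ^ 2 := by
    rw [cosh_sq_half_rho, kappa_unitLift]
  have hn : ‖h‖ = Real.cosh (rho x y / 2) := by
    rw [Complex.normSq_eq_norm_sq] at hk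
    exact (pow_left_inj₀ (norm_nonneg _) (Real.cosh_pos _).le two_ne_zero).1 hk
  have hc0 : (Real.cosh (rho x y / 2) : ℂ) ≠ 0 := by exact_mod_cast (Real.cosh_pos _).ne'
  have hmul : h * star h = (Real.cosh (rho x y / 2) : ℂ) ^ 2 := by
    rw [Complex.star_def, Complex.mul_conj, hk]; push_cast; ring
  have hstar : star (-(h / (Real.cosh (rho x y / 2) : ℂ))) =
      -(star h / (Real.cosh (rho x y / 2) : ℂ)) := by
    rw [star_neg, star_div₀, Complex.star_def, Complex.conj_ofReal]
  have hh0 : h ≠ 0 := by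
    intro h0
    rw [h0, zero_mul] at hmul
    exact hc0 (pow_eq_zero_iff two_ne_zero |>.1 hmul.symm)
  -- Since `‖h‖` is the hyperbolic cosine, the factor is a phase, chosen to turn `h` into `-‖h‖`.
  refine ⟨unitLift x, (-(h / (Real.cosh (rho x y / 2) : ℂ))) • unitLift y, _, _,
    unitLift_scale_ne_zero x, mul_ne_zero (neg_ne_zero.2 (div_ne_zero hh0 hc0))
      (unitLift_scale_ne_zero y), rfl, ?_, herm_unitLift x, ?_, ?_⟩
  · rw [unitLift, smul_smul]
  · rw [herm_smul_left, herm_smul_right, herm_unitLift, hstar]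
    field_simp
    linear_combination -hmul
  · rw [herm_smul_right, ← hh, hstar]
    field_simp
    linear_combination -hmul

/-- Two points are joined by a connected set of points `z` with `ρ(x,z) + ρ(z,y) = ρ(x,y)`. -/
theorem exists_isPreconnected_rho_add_eq (x y : H2) :
    ∃ S : Set H2, IsPreconnected S ∧ x ∈ S ∧ y ∈ S ∧
      ∀ z ∈ S, rho x z + rho z y = rho x y := by
  obtain ⟨X, Y, a, b, ha, hb, hXa, hYb, hX, hY, hXY⟩ := exists_aligned_lifts x y
  set C := Real.cosh (rho x y / 2) with hC
  have hC1 : 1 ≤ C := Real.one_le_cosh _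
  -- The connected set is the projection of the chord from `X` to `Y`; `N s` is minus the norm of
  -- the chord point `Z s`.
  let N : ℝ → ℝ := fun s => (1 - s) ^ 2 + s ^ 2 + 2 * s * (1 - s) * C
  have hN : ∀ s ∈ Set.Icc (0 : ℝ) 1, 0 < N s := by
    rintro s ⟨h0, h1⟩
    have h2 : 0 ≤ s * (1 - s) := mul_nonneg h0 (by linarith)
    have h3 : N s = 1 + 2 * (s * (1 - s)) * (C - 1) := by simp only [N]; ring
    rw [h3]
    have : 0 ≤ 2 * (s * (1 - s)) * (C - 1) := mul_nonneg (by linarith) (by linarith)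
    linarith
  let Z : ℝ → Fin 3 → ℂ := fun s => ((1 - s : ℝ) : ℂ) • X + (s : ℂ) • Y
  have hZ : ∀ s, (herm (Z s) (Z s)).re = -N s := by
    intro s
    rw [herm_real_combination hX hY hXY, Complex.ofReal_re]
    simp only [N]; ring
  have hZneg : ∀ s : Set.Icc (0 : ℝ) 1, (herm (Z s) (Z s)).re < 0 := fun s => by
    rw [hZ]
    linarith [hN s s.2]
  have hZcont : Continuous fun s : Set.Icc (0 : ℝ) 1 => Z s := by
    simp only [Z]
    fun_prop
  have hXZ : ∀ s, herm X (Z s) = ((-((1 - s) + s * C) : ℝ) : ℂ) := by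
    intro s
    have := herm_real_combination hX hY hXY 1 0 (1 - s) s
    simp only [Complex.ofReal_one, one_smul, Complex.ofReal_zero, zero_smul, add_zero] at this
    rw [this]
    congr 1; ring
  have hZY : ∀ s, herm (Z s) Y = ((-((1 - s) * C + s) : ℝ) : ℂ) := by
    intro s
    have := herm_real_combination hX hY hXY (1 - s) s 0 1
    simp only [Complex.ofReal_one, one_smul, Complex.ofReal_zero, zero_smul, zero_add] at this
    rw [this]
    congr 1; ring
  refine ⟨Set.range fun s : Set.Icc (0 : ℝ) 1 => proj (Z s) (hZneg s),
    isPreconnected_range (Continuous.proj hZcont hZneg), ⟨⟨0, by simp⟩, ?_⟩, ⟨⟨1, by simp⟩, ?_⟩, ?_⟩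
  · conv_rhs => rw [← proj_lift x]
    exact proj_eq _ _ a (by simp [Z, hXa])
  · conv_rhs => rw [← proj_lift y]
    exact proj_eq _ _ b (by simp [Z, hYb])
  rintro _ ⟨⟨s, hs⟩, rfl⟩
  simp only
  set z := proj (Z s) (hZneg ⟨s, hs⟩) with hz
  have hNs := hN s hs
  have hX' : lift x = a⁻¹ • X := by rw [hXa, inv_smul_smul₀ ha]
  have hY' : lift y = b⁻¹ • Y := by rw [hYb, inv_smul_smul₀ hb]
  have k1 : kappa (lift x) (lift z) = ((1 - s) + s * C) ^ 2 / N s := by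
    rw [hz, lift_proj, kappa_smul_right (inv_ne_zero (ne_zero_of_neg (hZneg ⟨s, hs⟩))), hX',
      kappa_smul_left (inv_ne_zero ha), kappa, hXZ, hZ, hX, Complex.normSq_ofReal]
    simp only [Complex.neg_re, Complex.one_re]
    congr 1 <;> ring
  have k2 : kappa (lift z) (lift y) = ((1 - s) * C + s) ^ 2 / N s := by
    rw [hz, lift_proj, kappa_smul_left (inv_ne_zero (ne_zero_of_neg (hZneg ⟨s, hs⟩))), hY',
      kappa_smul_right (inv_ne_zero hb), kappa, hZY, hZ, hY, Complex.normSq_ofReal]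
    simp only [Complex.neg_re, Complex.one_re]
    congr 1 <;> ring
  obtain ⟨h0, h1⟩ := hs
  have hR := Real.sq_sqrt hNs.le
  have hRpos : 0 < Real.sqrt (N s) := Real.sqrt_pos.2 hNs
  set R := Real.sqrt (N s)
  -- `T` is the hyperbolic sine of half the distance. Sines and cosines of both partial
  -- half-distances become explicit, and the addition formula for `cosh` finishes.
  have hT := Real.sq_sqrt (show 0 ≤ C ^ 2 - 1 by nlinarith)
  have hTnn := Real.sqrt_nonneg (C ^ 2 - 1)
  set T := Real.sqrt (C ^ 2 - 1)
  have c1 : Real.cosh (rho x z / 2) = ((1 - s) + s * C) / R := by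
    refine (pow_left_inj₀ (Real.cosh_pos _).le (div_nonneg (by nlinarith) hRpos.le) two_ne_zero).1 ?_
    rw [cosh_sq_half_rho, k1, div_pow, hR]
  have c2 : Real.cosh (rho z y / 2) = ((1 - s) * C + s) / R := by
    refine (pow_left_inj₀ (Real.cosh_pos _).le (div_nonneg (by nlinarith) hRpos.le) two_ne_zero).1 ?_
    rw [cosh_sq_half_rho, k2, div_pow, hR]
  have s1 : Real.sinh (rho x z / 2) = s * T / R := by
    refine (pow_left_inj₀ (Real.sinh_nonneg_iff.2 (by linarith [rho_nonneg x z])) (by positivity)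
      two_ne_zero).1 ?_
    rw [sinh_sq_half_rho, k1, div_pow, hR, mul_pow, hT]
    field_simp
    simp only [N]; ring
  have s2 : Real.sinh (rho z y / 2) = (1 - s) * T / R := by
    refine (pow_left_inj₀ (Real.sinh_nonneg_iff.2 (by linarith [rho_nonneg z y]))
      (div_nonneg (mul_nonneg (by linarith) hTnn) hRpos.le) two_ne_zero).1 ?_
    rw [sinh_sq_half_rho, k2, div_pow, hR, mul_pow, hT]
    field_simp
    simp only [N]; ring
  have hsum : Real.cosh (rho x z / 2 + rho z y / 2) = Real.cosh (rho x y / 2) := by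
    rw [Real.cosh_add, c1, c2, s1, s2, ← hC]
    have : ((1 - s) + s * C) / R * (((1 - s) * C + s) / R) + s * T / R * ((1 - s) * T / R)
        = (((1 - s) + s * C) * ((1 - s) * C + s) + s * (1 - s) * T ^ 2) / R ^ 2 := by
      field_simp
    rw [this, hT, hR, div_eq_iff hNs.ne']
    simp only [N]; ring
  have := Real.cosh_injOn (Set.mem_Ici.2 (by linarith [rho_nonneg x z, rho_nonneg z y]))
    (Set.mem_Ici.2 (by linarith [rho_nonneg x y])) hsum
  linarith

/-! ### Complex lines with positive distance have disjoint closures -/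

theorem closure_subset_of_polar {L : Set H2} {n : Fin 3 → ℂ}
    (hL : L ⊆ {p | herm (lift p) n = 0}) :
    closure ((fun x : H2 => (x : ℂ × ℂ)) '' L) ⊆
      {v | ‖v.1‖ ^ 2 + ‖v.2‖ ^ 2 ≤ 1 ∧ herm ![v.1, v.2, 1] n = 0} := by
  apply closure_minimal
  · rintro _ ⟨p, hp, rfl⟩
    exact ⟨p.2.le, hL hp⟩
  · have h1 : IsClosed {v : ℂ × ℂ | ‖v.1‖ ^ 2 + ‖v.2‖ ^ 2 ≤ 1} :=
      isClosed_le (by fun_prop) continuous_const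
    have h2 : IsClosed {v : ℂ × ℂ | herm ![v.1, v.2, 1] n = 0} := by
      refine isClosed_eq ?_ continuous_const
      simp only [herm, Matrix.cons_val_zero, Matrix.cons_val_one, Matrix.cons_val]
      fun_prop
    exact h1.inter h2

/-- Suppose the closures share `v`, and move from `v` towards an interior point `u` of `L` by a
parameter `t`. The moving point stays in `L`, its component along the polar vector of `L'` is of
order `t`, and minus its norm is at least of order `t`. So `sinh²` of half its distance to its
projection on `L'` is at most of order `t²/t`, which tends to zero. -/
theorem disjoint_closure_of_le_rho {L L' : Set H2} (hL : IsComplexLine L)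
    (hL' : IsComplexLine L') (hne : L.Nonempty) {c : ℝ} (hc : 0 < c)
    (h : ∀ x ∈ L, ∀ y ∈ L', c ≤ rho x y) :
    Disjoint (closure ((fun x : H2 => (x : ℂ × ℂ)) '' L'))
      (closure ((fun x : H2 => (x : ℂ × ℂ)) '' L)) := by
  obtain ⟨n, hn, rfl⟩ := hL
  obtain ⟨m, hm, rfl⟩ := hL'
  obtain ⟨u, hu⟩ := hne
  rw [Set.disjoint_left]
  intro v hv' hv
  obtain ⟨hv1, hvn⟩ := closure_subset_of_polar subset_rfl hv
  obtain ⟨-, hvm⟩ := closure_subset_of_polar subset_rfl hv'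
  have hsq : ∀ (t : ℝ) (z w : ℂ), 0 ≤ t → t ≤ 1 →
      ‖(1 - t) * z + t * w‖ ^ 2 ≤ (1 - t) * ‖z‖ ^ 2 + t * ‖w‖ ^ 2 := by
    intro t z w h0 h1
    have hz : ∀ z : ℂ, ‖z‖ ^ 2 = z.re ^ 2 + z.im ^ 2 := by
      intro z
      rw [← Complex.normSq_eq_norm_sq, Complex.normSq_apply]; ring
    simp only [hz, Complex.add_re, Complex.add_im, Complex.mul_re, Complex.mul_im,
      Complex.sub_re, Complex.sub_im, Complex.one_re, Complex.one_im, Complex.ofReal_re,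
      Complex.ofReal_im]
    nlinarith [mul_nonneg (mul_nonneg h0 (sub_nonneg.2 h1))
      (add_nonneg (sq_nonneg (z.re - w.re)) (sq_nonneg (z.im - w.im)))]
  have hpt : ∀ t : ℝ, 0 < t → t ≤ 1 →
      ‖(1 - t) * v.1 + t * u.1.1‖ ^ 2 + ‖(1 - t) * v.2 + t * u.1.2‖ ^ 2
        ≤ 1 - t * (1 - (‖u.1.1‖ ^ 2 + ‖u.1.2‖ ^ 2)) := by
    intro t h0 h1
    have e1 := hsq t v.1 u.1.1 h0.le h1
    have e2 := hsq t v.2 u.1.2 h0.le h1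
    nlinarith
  have hK : 0 < 1 - (‖u.1.1‖ ^ 2 + ‖u.1.2‖ ^ 2) := by linarith [u.2]
  set K := 1 - (‖u.1.1‖ ^ 2 + ‖u.1.2‖ ^ 2)
  have key : ∀ t : ℝ, 0 < t → t ≤ 1 → Real.sinh (c / 2) ^ 2 ≤
      t * (Complex.normSq (herm (lift u) m) / (K * (herm m m).re)) := by
    intro t h0 h1
    let p : H2 := ⟨((1 - t) * v.1 + t * u.1.1, (1 - t) * v.2 + t * u.1.2), by
      have := hpt t h0 h1
      have := mul_pos h0 hK
      simp only
      linarith⟩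
    have hplift : lift p = ((1 - t : ℝ) : ℂ) • ![v.1, v.2, 1] + (t : ℂ) • lift u := by
      funext i
      fin_cases i <;> simp [lift, p]
    have hpn : herm (lift p) n = 0 := by
      rw [hplift, herm_add_left, herm_smul_left, herm_smul_left, hvn, hu]
      simp
    have hpm : herm (lift p) m = t * herm (lift u) m := by
      rw [hplift, herm_add_left, herm_smul_left, herm_smul_left, hvm]
      simp
    have hpneg := herm_lift_neg p
    have hpp : (herm (lift p) (lift p)).re ≤ - (t * K) := by
      rw [herm_self_re]
      have := hpt t h0 h1
      simp only [lift, p, Matrix.cons_val_zero, Matrix.cons_val_one, Matrix.cons_val, norm_one]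
      linarith
    set w := lift p - (herm (lift p) m / herm m m) • m with hw
    have hww : (herm w w).re = (herm (lift p) (lift p)).re
        - t ^ 2 * Complex.normSq (herm (lift u) m) / (herm m m).re := by
      rw [hw, sub_smul_herm_self_re hm.ne', hpm, map_mul, Complex.normSq_ofReal, ← sq]
    have hwneg : (herm w w).re < 0 := by
      rw [hww]
      have : 0 ≤ t ^ 2 * Complex.normSq (herm (lift u) m) / (herm m m).re :=
        div_nonneg (mul_nonneg (sq_nonneg _) (Complex.normSq_nonneg _)) hm.le
      linarith
    have hm0 : herm m m ≠ 0 := fun h => by rw [h] at hm; simp at hm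
    have hwm : herm w m = 0 := by
      rw [hw, herm_sub_left, herm_smul_left]
      field_simp
      ring
    have hpw : herm (lift p) w = herm w w := by
      have : lift p = w + (herm (lift p) m / herm m m) • m := by rw [hw]; abel
      conv_lhs => rw [this]
      rw [herm_add_left, herm_smul_left, herm_eq_zero_comm.1 hwm, mul_zero, add_zero]
    have hq : proj w hwneg ∈ {p | herm (lift p) m = 0} := by
      simp only [Set.mem_ofPred_eq]
      rw [lift_proj, herm_smul_left, hwm, mul_zero]
    have hkap : kappa (lift p) (lift (proj w hwneg)) - 1 =
        t ^ 2 * Complex.normSq (herm (lift u) m)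
          / ((herm m m).re * -(herm (lift p) (lift p)).re) := by
      rw [lift_proj, kappa_smul_right (inv_ne_zero (ne_zero_of_neg hwneg)), kappa, hpw,
        herm_self w, Complex.normSq_ofReal, Complex.ofReal_re,
        mul_div_mul_right _ _ hwneg.ne, hww]
      have := hpneg.ne
      field_simp
      ring
    have h1 := h p hpn _ hq
    have h2 : Real.sinh (c / 2) ≤ Real.sinh (rho p (proj w hwneg) / 2) :=
      Real.sinh_le_sinh.2 (by linarith)
    have h3 : Real.sinh (c / 2) ^ 2 ≤ Real.sinh (rho p (proj w hwneg) / 2) ^ 2 :=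
      pow_le_pow_left₀ (Real.sinh_nonneg_iff.2 (by linarith)) h2 2
    rw [sinh_sq_half_rho, hkap] at h3
    refine h3.trans ?_
    have hns := Complex.normSq_nonneg (herm (lift u) m)
    rw [← mul_div_assoc, div_le_div_iff₀ (mul_pos hm (by linarith)) (by positivity)]
    have : t * Complex.normSq (herm (lift u) m) * (herm m m).re * (t * K)
        ≤ t * Complex.normSq (herm (lift u) m) * (herm m m).re *
          -(herm (lift p) (lift p)).re :=
      mul_le_mul_of_nonneg_left (by linarith) (by positivity)
    linarith
  have hpos : 0 < Real.sinh (c / 2) ^ 2 := by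
    have := Real.sinh_pos_iff.2 (half_pos hc)
    positivity
  have hM : 0 ≤ Complex.normSq (herm (lift u) m) / (K * (herm m m).re) :=
    div_nonneg (Complex.normSq_nonneg _) (by positivity)
  set M := Complex.normSq (herm (lift u) m) / (K * (herm m m).re)
  have hlim : Filter.Tendsto (fun t : ℝ => t * M) (nhdsWithin 0 (Set.Ioi 0)) (nhds 0) := by
    have : Filter.Tendsto (fun t : ℝ => t * M) (nhds 0) (nhds (0 * M)) :=
      (continuous_id.mul continuous_const).tendsto 0
    rw [zero_mul] at this
    exact this.mono_left nhdsWithin_le_nhds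
  have hle := ge_of_tendsto hlim (b := Real.sinh (c / 2) ^ 2) (by
    filter_upwards [Ioc_mem_nhdsGT (zero_lt_one (α := ℝ))] with t ht
    exact key t ht.1 ht.2)
  linarith

theorem IsComplexLine.smul {L : Set H2} (hL : IsComplexLine L) (g : PU21) :
    IsComplexLine ((fun x => g • x) '' L) := by
  obtain ⟨n, hn, rfl⟩ := hL
  induction g using QuotientGroup.induction_on with
  | H g =>
    refine ⟨g.1.1.mulVec n, by rwa [g.2], ?_⟩
    have hmem : ∀ p, herm (lift ((g : PU21) • p)) (g.1.1.mulVec n) = 0 ↔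
        herm (lift p) n = 0 := by
      intro p
      rw [mk_smul, lift_proj, herm_smul_left, g.2, mul_eq_zero]
      simp [ne_zero_of_neg (mulVec_neg g p)]
    ext p
    constructor
    · rintro ⟨q, hq, rfl⟩
      exact (hmem q).2 hq
    · intro hp
      refine ⟨(g : PU21)⁻¹ • p, (hmem _).1 ?_, smul_inv_smul _ _⟩
      rw [smul_inv_smul]
      exact hp

instance (Γ : Subgroup PU21) : ContinuousConstSMul Γ H2 where
  continuous_const_smul g := continuous_const_smul (g : PU21)

/-! ### Embedded surfaces from uniform separation of the translates -/

/-- An element of `Γ` bringing a point of `L` within distance less than `c` of `L` must lie in `Γ₀`.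
At distance zero this gives injectivity; on a neighbourhood of `L` it gives the topology. -/
theorem isEmbeddedSurface_of_separated {Γ₀ Γ : Subgroup PU21} (h : Γ₀ ≤ Γ) {L : Set H2}
    (hL : IsComplexLine L) (hne : L.Nonempty) (hinv : ∀ g ∈ Γ₀, ∀ x ∈ L, g • x ∈ L)
    {c : ℝ} (hc : 0 < c)
    (hsep : ∀ g ∈ Γ, g ∉ Γ₀ → ∀ x ∈ L, ∀ y ∈ L, c ≤ rho y (g • x)) :
    IsEmbeddedSurface h L := by
  have hmem : ∀ g ∈ Γ, ∀ x ∈ L, ∀ y ∈ L, rho y (g • x) < c → g ∈ Γ₀ := by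
    intro g hg x hx y hy hlt
    by_contra hg0
    exact absurd (hsep g hg hg0 x hx y hy) (not_le.2 hlt)
  refine ⟨⟨⟨le_antisymm ?_ ?_⟩, ?_⟩, ?_⟩
  · rw [← continuous_iff_le_induced]
    exact continuous_quot_lift _ (continuous_quot_mk.comp continuous_subtype_val)
  · intro U hU
    obtain ⟨O, hO, hOU⟩ := isOpen_induced_iff.1 (hU.preimage continuous_quot_mk)
    -- Inside this `c`-neighbourhood only `Γ₀`-translates of points of `L` occur, so the image of `O
    -- ∩ N` in the quotient pulls back to exactly `U`.
    have hN : IsOpen (⋃ x ∈ L, {y | rho x y < c}) :=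
      isOpen_biUnion fun x _ =>
        isOpen_lt (Continuous.rho continuous_const continuous_id) continuous_const
    refine isOpen_induced_iff.2 ⟨_, isOpenMap_quotient_mk'_mul (Γ := Γ) _ (hO.inter hN), ?_⟩
    ext u
    induction u using Quotient.inductionOn with
    | h x =>
    have hxU : ∀ z : L, z.1 ∈ O ↔ (Quotient.mk _ z : Surf Γ₀ L) ∈ U := fun z =>
      (Set.ext_iff.1 hOU z)
    constructor
    · rintro ⟨y, ⟨hyO, hyN⟩, hxy⟩
      obtain ⟨⟨g, hg⟩, hgy⟩ := Quotient.exact hxy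
      simp only [Set.mem_iUnion] at hyN
      obtain ⟨z, hz, hzy⟩ := hyN
      change g • x.1 = y at hgy
      have hg0 : g ∈ Γ₀ := hmem g hg x x.2 z hz (by rw [hgy]; exact hzy)
      have hyL : y ∈ L := hgy ▸ hinv g hg0 x x.2
      have h1 := (hxU ⟨y, hyL⟩).1 hyO
      have h2 : (Quotient.mk _ ⟨y, hyL⟩ : Surf Γ₀ L) = Quotient.mk _ x :=
        Quotient.sound ⟨⟨g, hg0⟩, hgy⟩
      rwa [h2] at h1
    · intro hx
      refine ⟨x.1, ⟨(hxU x).2 hx, ?_⟩, rfl⟩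
      simp only [Set.mem_iUnion]
      exact ⟨x.1, x.2, by change rho _ _ < c; rwa [rho_self]⟩
  · intro u v huv
    induction u using Quotient.inductionOn with
    | h x =>
    induction v using Quotient.inductionOn with
    | h y =>
    obtain ⟨⟨g, hg⟩, hgy⟩ := Quotient.exact huv
    change g • y.1 = x.1 at hgy
    have hg0 : g ∈ Γ₀ := hmem g hg y y.2 x x.2 (by rw [hgy, rho_self]; exact hc)
    exact Quotient.sound ⟨⟨g, hg0⟩, hgy⟩
  · intro g hg hgL
    have hg0 : g ∉ Γ₀ := by
      intro hg0
      apply hgL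
      ext x
      constructor
      · rintro ⟨y, hy, rfl⟩
        exact hinv g hg0 y hy
      · intro hx
        exact ⟨g⁻¹ • x, hinv _ (inv_mem hg0) x hx, smul_inv_smul _ _⟩
    refine disjoint_closure_of_le_rho hL (hL.smul g) hne hc ?_
    rintro x hx _ ⟨y, hy, rfl⟩
    exact hsep g hg hg0 y hy x hx

/-! ### The combination theorem -/

/-- Ping-pong configuration for two groups leaving complex lines invariant: `A b` is closed, every
nontrivial element of `Γ b` maps the complement of `A b` into `A b`, and `θ b` is a lower bound
for the distance to `L b`, at most `s b` on `A b`, with `θ true + θ false ≥ ℓ`. -/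
structure PingPong (Γ : Bool → Subgroup PU21) (L A : Bool → Set H2) (θ : Bool → H2 → ℝ)
    (s : Bool → ℝ) (ℓ : ℝ) : Prop where
  invariant : ∀ b, ∀ g ∈ Γ b, ∀ x ∈ L b, g • x ∈ L b
  smul_mem : ∀ b, ∀ g ∈ Γ b, g ≠ 1 → ∀ x ∉ A b, g • x ∈ A b
  closed : ∀ b, IsClosed (A b)
  lt_of_mem : ∀ b, ∀ x ∈ A b, θ b x < s b
  le_add : ∀ b x, ℓ ≤ θ b x + θ (!b) x
  le_rho : ∀ b, ∀ x ∈ L b, ∀ y, θ b y ≤ rho x y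
  nonneg : ∀ b, 0 ≤ s b
  add_lt : ∀ b, s b + s (!b) < ℓ
  base : ∃ x, ∀ b, x ∉ A b

namespace PingPong

open Monoid CoprodI

variable {Γ : Bool → Subgroup PU21} {L A : Bool → Set H2} {θ : Bool → H2 → ℝ} {s : Bool → ℝ}
  {ℓ : ℝ}

/-- The homomorphism from the free product induced by the inclusions. -/
def hom (Γ : Bool → Subgroup PU21) : CoprodI (fun b => Γ b) →* PU21 :=
  CoprodI.lift fun b => (Γ b).subtype

theorem hom_of (b : Bool) (g : Γ b) : hom Γ (of g) = g := CoprodI.lift_of _ _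

theorem range_hom : (hom Γ).range = Γ true ⊔ Γ false := by
  rw [hom, range_eq_iSup]
  simp [iSup_bool_eq]

variable (P : PingPong Γ L A θ s ℓ)
include P

theorem disjoint {b : Bool} {x : H2} (hx : x ∈ A b) : x ∉ A (!b) := fun hx' => by
  linarith [P.lt_of_mem b x hx, P.lt_of_mem (!b) x hx', P.le_add b x, P.add_lt b]

theorem notMem_of_mem_line {b : Bool} {x : H2} (hx : x ∈ L b) : x ∉ A (!b) := fun hx' => by
  have h := P.le_rho b x hx x
  rw [rho_self] at h
  linarith [P.lt_of_mem (!b) x hx', P.le_add b x, P.add_lt b, P.nonneg b]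

/-- The ping-pong: each syllable lands in its own set, which is disjoint from the set that the next
syllable must avoid. -/
theorem neWord_smul_mem {i j : Bool} (w : NeWord (fun b => Γ b) i j) {x : H2} (hx : x ∉ A j) :
    hom Γ w.prod • x ∈ A i := by
  induction w generalizing x with
  | singleton g hg =>
    rw [NeWord.prod_singleton, hom_of]
    exact P.smul_mem _ _ g.2 (by simpa using hg) x hx
  | @append i j k l w₁ hne w₂ ih₁ ih₂ =>
    rw [NeWord.append_prod, map_mul, mul_smul]
    refine ih₁ ?_
    obtain rfl : j = !k := by simpa [Bool.eq_not_iff] using hne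
    exact P.disjoint (ih₂ hx)

theorem hom_injective : Function.Injective (hom Γ) := by
  rw [injective_iff_map_eq_one]
  intro x hx
  rcases eq_one_or_exists_neWord x with h | ⟨i, j, w, rfl⟩
  · exact h
  · obtain ⟨x₀, hx₀⟩ := P.base
    have := P.neWord_smul_mem w (hx₀ j)
    rw [hx, one_smul] at this
    exact absurd this (hx₀ i)

/-- Every nontrivial element pushes the base point into one of the closed sets, so keeping it
outside both is an open condition that isolates the identity. -/
theorem isDiscreteTorsionFree (htf : ∀ b, ∀ g ∈ Γ b, IsOfFinOrder g → g = 1) :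
    IsDiscreteTorsionFree (Γ true ⊔ Γ false) := by
  constructor
  · obtain ⟨x₀, hx₀⟩ := P.base
    have hopen : IsOpen {g : ↥(Γ true ⊔ Γ false) | ∀ b, (g : PU21) • x₀ ∈ (A b)ᶜ} := by
      have h : ∀ b, IsOpen {g : ↥(Γ true ⊔ Γ false) | (g : PU21) • x₀ ∈ (A b)ᶜ} := fun b =>
        (P.closed b).isOpen_compl.preimage
          ((continuous_smul_right x₀).comp continuous_subtype_val)
      convert (h true).inter (h false) using 1
      ext g
      simp [and_comm]
    have hsing : {g : ↥(Γ true ⊔ Γ false) | ∀ b, (g : PU21) • x₀ ∈ (A b)ᶜ} = {1} := by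
      ext g
      constructor
      · intro hg
        obtain ⟨x, hx⟩ : (g : PU21) ∈ (hom Γ).range := by rw [range_hom]; exact g.2
        rcases eq_one_or_exists_neWord x with rfl | ⟨i, j, w, rfl⟩
        · rw [map_one] at hx
          exact Subtype.ext hx.symm
        · have := P.neWord_smul_mem w (hx₀ j)
          rw [hx] at this
          exact absurd this (hg i)
      · rintro rfl b
        simpa using hx₀ b
    rw [hsing] at hopen
    exact discreteTopology_of_isOpen_singleton_one hopen
  · intro g hg hfin
    obtain ⟨x, rfl⟩ : g ∈ (hom Γ).range := by rw [range_hom]; exact hg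
    have hx : IsOfFinOrder x := P.hom_injective.isOfFinOrder_iff.1 hfin
    rw [CoprodI.eq_one_of_isOfFinOrder ?_ x hx, map_one]
    intro b g hg
    have := htf b g g.2 ((Γ b).subtype.isOfFinOrder hg)
    exact Subtype.ext this

theorem exists_coprod_equiv : ∃ e : Coprod (Γ true) (Γ false) ≃* ↥(Γ true ⊔ Γ false),
    (∀ g : Γ true, ((e (Coprod.inl g) : ↥(Γ true ⊔ Γ false)) : PU21) = g) ∧
    (∀ g : Γ false, ((e (Coprod.inr g) : ↥(Γ true ⊔ Γ false)) : PU21) = g) := by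
  refine ⟨(boolEquiv fun b => Γ b).trans ((MonoidHom.ofInjective P.hom_injective).trans
    (MulEquiv.subgroupCongr range_hom)), fun g => ?_, fun g => ?_⟩
  · exact hom_of true g
  · exact hom_of false g

/-- Up to factors in `Γ b`, which preserve `L b`, the element is a word beginning and ending in the
other group. It carries `L b` into `A (!b)`, where `θ (!b)` is small and so `θ b` is large. -/
theorem separated_same (b : Bool) {g : PU21} (hg : g ∈ Γ true ⊔ Γ false) (hgb : g ∉ Γ b)
    {x y : H2} (hx : x ∈ L b) (hy : y ∈ L b) : ℓ - (s b + s (!b)) ≤ rho y (g • x) := by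
  obtain ⟨z, rfl⟩ : g ∈ (hom Γ).range := by rw [range_hom]; exact hg
  rcases exists_mul_neWord_mul_same b z with ⟨g, rfl⟩ | ⟨a, c, w, rfl⟩
  · rw [hom_of] at hgb
    exact absurd g.2 hgb
  · rw [map_mul, map_mul, hom_of, hom_of, mul_smul, mul_smul, ← rho_smul (a : PU21)⁻¹,
      inv_smul_smul]
    have h1 := P.invariant b c c.2 x hx
    have h2 := P.lt_of_mem _ _ (P.neWord_smul_mem w (P.notMem_of_mem_line h1))
    have h3 := P.le_rho b _ (P.invariant b _ (inv_mem a.2) y hy)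
      (hom Γ w.prod • (c : PU21) • x)
    linarith [P.le_add b (hom Γ w.prod • (c : PU21) • x), P.nonneg b]

/-- After stripping letters that preserve the lines, the remaining word `v` begins in the group `!b`
and ends in the group `b`. Then `A (!b)` and `v • A b` are closed and cover the whole ball, so a
geodesic from `x'` to `v • y'` has a point `z` in both. Its two pieces are longer than `ℓ - s (!b)`
and `ℓ - s b`, together more than `ℓ`. -/
theorem separated_ne (b : Bool) {d : ℝ} (hd : ∀ x ∈ L b, ∀ y ∈ L (!b), d ≤ rho x y) (hdℓ : d ≤ ℓ)
    {g : PU21} (hg : g ∈ Γ true ⊔ Γ false) {x y : H2} (hx : x ∈ L b) (hy : y ∈ L (!b)) :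
    d ≤ rho x (g • y) := by
  obtain ⟨z, rfl⟩ : g ∈ (hom Γ).range := by rw [range_hom]; exact hg
  rcases exists_mul_neWord_mul_ne b z with ⟨a, c, rfl⟩ | ⟨a, c, w, rfl⟩
  · rw [map_mul, hom_of, hom_of, mul_smul, ← rho_smul (a : PU21)⁻¹, inv_smul_smul]
    exact hd _ (P.invariant _ _ (inv_mem a.2) _ hx) _ (P.invariant _ _ c.2 _ hy)
  · rw [map_mul, map_mul, hom_of, hom_of, mul_smul, mul_smul, ← rho_smul (a : PU21)⁻¹,
      inv_smul_smul]
    have hx' := P.invariant _ _ (inv_mem a.2) _ hx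
    have hy' := P.invariant _ _ c.2 _ hy
    set x' := (a : PU21)⁻¹ • x
    set y' := (c : PU21) • y
    set v := hom Γ w.prod
    have hmove : ∀ z, z ∉ A (!b) → v⁻¹ • z ∈ A b := by
      intro z hz
      have := P.neWord_smul_mem w.inv hz
      rwa [NeWord.inv_prod, map_inv] at this
    obtain ⟨S, hS, hxS, hyS, hadd⟩ := exists_isPreconnected_rho_add_eq x' (v • y')
    have hclosed : IsClosed ((fun z => v⁻¹ • z) ⁻¹' A b) :=
      (P.closed b).preimage (continuous_const_smul _)
    obtain ⟨z, hzS, hz1, hz2⟩ := isPreconnected_closed_iff.1 hS _ _ (P.closed (!b)) hclosed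
      (fun z _ => by
        by_cases hz : z ∈ A (!b)
        · exact Or.inl hz
        · exact Or.inr (hmove z hz))
      ⟨v • y', hyS, P.neWord_smul_mem w (by simpa using P.notMem_of_mem_line hy')⟩
      ⟨x', hxS, hmove _ (P.notMem_of_mem_line hx')⟩
    have e1 := P.le_rho b _ hx' z
    have e2 := P.le_rho (!b) _ hy' (v⁻¹ • z)
    have e3 : rho z (v • y') = rho y' (v⁻¹ • z) := by
      rw [← rho_smul v⁻¹, inv_smul_smul, rho_comm]
    have e4 := P.lt_of_mem _ _ hz1
    have e5 := P.lt_of_mem _ _ hz2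
    linarith [hadd z hzS, P.le_add b z, P.le_add b (v⁻¹ • z), P.add_lt b]

theorem setDist_rhoQuot (hne : ∀ b, (L b).Nonempty) (hdℓ : setDist rho (L true) (L false) ≤ ℓ)
    {Γ' : Subgroup PU21} (hΓ' : Γ true ⊔ Γ false = Γ') (h₁ : Γ true ≤ Γ') (h₂ : Γ false ≤ Γ') :
    setDist (rhoQuot Γ') (Set.range (surfMap h₁ (L true))) (Set.range (surfMap h₂ (L false)))
      = setDist rho (L true) (L false) := by
  have hbdd : ∀ S T : Set H2, BddBelow (Set.image2 rho S T) := by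
    refine fun S T => ⟨0, ?_⟩
    rintro _ ⟨x, -, y, -, rfl⟩
    exact rho_nonneg x y
  have hd : ∀ x ∈ L true, ∀ y ∈ L false, setDist rho (L true) (L false) ≤ rho x y :=
    fun x hx y hy => csInf_le (hbdd _ _) ⟨x, hx, y, hy, rfl⟩
  obtain ⟨x₀, hx₀⟩ := hne true
  obtain ⟨y₀, hy₀⟩ := hne false
  have hlow : ∀ (x : L true) (y : L false), setDist rho (L true) (L false) ≤
      rhoQuot Γ' (Quotient.mk _ x.1) (Quotient.mk _ y.1) := by
    intro x y
    refine le_csInf ⟨_, x.1, rfl, y.1, rfl, rfl⟩ ?_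
    rintro _ ⟨x', hx', y', hy', rfl⟩
    obtain ⟨⟨g, hg⟩, hgx⟩ := Quotient.exact hx'
    obtain ⟨⟨k, hk⟩, hky⟩ := Quotient.exact hy'
    change g • x.1 = x' at hgx
    change k • y.1 = y' at hky
    rw [← hgx, ← hky, ← rho_smul g⁻¹, inv_smul_smul, ← mul_smul]
    exact P.separated_ne true hd hdℓ (hΓ'.symm ▸ mul_mem (inv_mem hg) hk) x.2 y.2
  apply le_antisymm
  · refine le_csInf ⟨_, x₀, hx₀, y₀, hy₀, rfl⟩ ?_
    rintro _ ⟨x, hx, y, hy, rfl⟩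
    have h1 : rhoQuot Γ' (Quotient.mk _ x) (Quotient.mk _ y) ≤ rho x y :=
      csInf_le (hbdd _ _) ⟨x, rfl, y, rfl, rfl⟩
    refine le_trans (csInf_le ⟨0, ?_⟩
      ⟨_, ⟨Quotient.mk _ ⟨x, hx⟩, rfl⟩, _, ⟨Quotient.mk _ ⟨y, hy⟩, rfl⟩, rfl⟩) h1
    rintro _ ⟨a, -, b, -, rfl⟩
    refine Real.sInf_nonneg ?_
    rintro _ ⟨x, -, y, -, rfl⟩
    exact rho_nonneg x y
  · refine le_csInf ⟨_, _, ⟨Quotient.mk _ ⟨x₀, hx₀⟩, rfl⟩, _,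
      ⟨Quotient.mk _ ⟨y₀, hy₀⟩, rfl⟩, rfl⟩ ?_
    rintro _ ⟨_, ⟨a, rfl⟩, _, ⟨b, rfl⟩, rfl⟩
    induction a using Quotient.inductionOn with
    | h x =>
    induction b using Quotient.inductionOn with
    | h y => exact hlow x y

end PingPong

/-! ### Hermitian cross product and orthonormal frames -/

/-- The determinant of three vectors of `ℂ³`. -/
noncomputable def det3 (x y z : Fin 3 → ℂ) : ℂ :=
  x 0 * (y 1 * z 2 - y 2 * z 1) + x 1 * (y 2 * z 0 - y 0 * z 2) + x 2 * (y 0 * z 1 - y 1 * z 0)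

/-- The Hermitian cross product. -/
noncomputable def hcross (u v : Fin 3 → ℂ) : Fin 3 → ℂ :=
  ![star (u 1 * v 2 - u 2 * v 1), star (u 2 * v 0 - u 0 * v 2), -star (u 0 * v 1 - u 1 * v 0)]

theorem herm_hcross (w u v : Fin 3 → ℂ) : herm w (hcross u v) = det3 w u v := by
  simp only [herm, hcross, det3, Matrix.cons_val_zero, Matrix.cons_val_one, Matrix.cons_val,
    star_star, star_neg]
  ring

theorem herm_hcross_self (u v : Fin 3 → ℂ) : herm (hcross u v) (hcross u v) =
    herm u v * herm v u - herm u u * herm v v := by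
  simp only [herm, hcross, Matrix.cons_val_zero, Matrix.cons_val_one, Matrix.cons_val,
    star_star, star_neg, star_sub, star_mul]
  ring

/-- The Gram determinant is the squared modulus of the determinant times `-1`, the determinant of
the form. -/
theorem gram_det (x y z : Fin 3 → ℂ) :
    herm x x * herm y y * herm z z + herm x y * herm y z * herm z x
      + herm x z * herm y x * herm z y - herm x x * herm y z * herm z y
      - herm x y * herm y x * herm z z - herm x z * herm y y * herm z x
      = -(det3 x y z * star (det3 x y z)) := by
  simp only [herm, det3, star_add, star_sub, star_mul]
  ring

/-- A vector orthogonal to three independent vectors vanishes. -/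
theorem eq_zero_of_herm_eq_zero {x y z u : Fin 3 → ℂ} (h : det3 x y z ≠ 0)
    (hx : herm u x = 0) (hy : herm u y = 0) (hz : herm u z = 0) : u = 0 := by
  rw [herm_eq_zero_comm] at hx hy hz
  simp only [herm] at hx hy hz
  -- Cramer's rule: the coefficients are cofactors.
  have h0 : det3 x y z * star (u 0) = 0 := by
    unfold det3
    linear_combination (y 1 * z 2 - y 2 * z 1) * hx + (z 1 * x 2 - z 2 * x 1) * hy
      + (x 1 * y 2 - x 2 * y 1) * hz
  have h1 : det3 x y z * star (u 1) = 0 := by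
    unfold det3
    linear_combination (y 2 * z 0 - y 0 * z 2) * hx + (z 2 * x 0 - z 0 * x 2) * hy
      + (x 2 * y 0 - x 0 * y 2) * hz
  have h2 : det3 x y z * star (u 2) = 0 := by
    unfold det3
    linear_combination -(y 0 * z 1 - y 1 * z 0) * hx - (z 0 * x 1 - z 1 * x 0) * hy
      - (x 0 * y 1 - x 1 * y 0) * hz
  funext i
  fin_cases i
  · simpa [h] using h0
  · simpa [h] using h1
  · simpa [h] using h2

/-- Orthonormal frames for the form of signature `(2,1)`. -/
structure IsFrame (c n P : Fin 3 → ℂ) : Prop where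
  cc : herm c c = 1
  nn : herm n n = 1
  PP : herm P P = -1
  cn : herm c n = 0
  cP : herm c P = 0
  nP : herm n P = 0

namespace IsFrame

variable {c n P : Fin 3 → ℂ}

theorem of_pair (hn : herm n n = 1) (hP : herm P P = -1) (hnP : herm n P = 0) :
    IsFrame (hcross P n) n P where
  cc := by
    rw [herm_hcross_self, hn, hP, hnP]
    simp
  nn := hn
  PP := hP
  cn := by
    rw [herm_eq_zero_comm, herm_hcross, det3]
    ring
  cP := by
    rw [herm_eq_zero_comm, herm_hcross, det3]
    ring
  nP := hnP

variable (F : IsFrame c n P)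
include F

theorem nc : herm n c = 0 := herm_eq_zero_comm.1 F.cn
theorem Pc : herm P c = 0 := herm_eq_zero_comm.1 F.cP
theorem Pn : herm P n = 0 := herm_eq_zero_comm.1 F.nP

theorem det3_ne_zero : det3 c n P ≠ 0 := by
  intro h
  have := gram_det c n P
  rw [F.cc, F.nn, F.PP, F.cn, F.cP, F.nP, F.nc, F.Pc, F.Pn, h] at this
  simp at this

theorem expand (v : Fin 3 → ℂ) :
    v = herm v c • c + herm v n • n - herm v P • P := by
  rw [← sub_eq_zero]
  refine eq_zero_of_herm_eq_zero F.det3_ne_zero ?_ ?_ ?_ <;>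
  · simp only [herm_sub_left, herm_add_left, herm_smul_left, F.cc, F.nn, F.PP, F.cn, F.cP, F.nP,
      F.nc, F.Pc, F.Pn]
    ring

theorem herm_eq (v w : Fin 3 → ℂ) : herm v w =
    herm v c * herm c w + herm v n * herm n w - herm v P * herm P w := by
  conv_lhs => rw [F.expand v]
  simp only [herm_sub_left, herm_add_left, herm_smul_left]

theorem herm_self_re_eq (v : Fin 3 → ℂ) : (herm v v).re =
    Complex.normSq (herm v c) + Complex.normSq (herm v n) - Complex.normSq (herm v P) := by
  rw [F.herm_eq v v, herm_mul_herm, herm_mul_herm, herm_mul_herm, Complex.sub_re, Complex.add_re,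
    Complex.ofReal_re, Complex.ofReal_re, Complex.ofReal_re]

end IsFrame

/-- A unit multiple of a positive vector. -/
theorem exists_unit_smul {v : Fin 3 → ℂ} (hv : 0 < (herm v v).re) :
    ∃ a : ℂ, a ≠ 0 ∧ herm (a • v) (a • v) = 1 := by
  have h := Real.sqrt_pos.2 hv
  refine ⟨(((Real.sqrt (herm v v).re)⁻¹ : ℝ) : ℂ), ?_, ?_⟩
  · exact_mod_cast (inv_pos.2 h).ne'
  · rw [herm_self, herm_smul_self_re, Complex.normSq_ofReal, ← mul_inv, Real.mul_self_sqrt hv.le,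
      inv_mul_cancel₀ hv.ne', Complex.ofReal_one]

theorem exists_frame {P : Fin 3 → ℂ} (hP : herm P P = -1) : ∃ c n, IsFrame c n P := by
  have hPre : (herm P P).re = -1 := by rw [hP]; simp
  -- Any positive vector would do: removing its component along the negative vector `P` only
  -- increases its norm.
  set e : Fin 3 → ℂ := ![1, 0, 0]
  have he : (herm e e).re = 1 := by simp [herm, e]
  set w := e - (herm e P / herm P P) • P with hw
  have hwP : herm w P = 0 := by
    rw [hw, herm_sub_left, herm_smul_left, hP]
    ring
  have hww : 0 < (herm w w).re := by
    rw [hw, sub_smul_herm_self_re (by rw [hPre]; norm_num), he, hPre]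
    have := Complex.normSq_nonneg (herm e P)
    rw [div_neg, div_one]
    linarith
  obtain ⟨a, -, ha⟩ := exists_unit_smul hww
  exact ⟨_, _, IsFrame.of_pair ha hP (by rw [herm_smul_left, hwP, mul_zero])⟩

/-! ### Point stabilizers are compact, discrete torsion-free groups act freely -/

theorem isClosedEmbedding_SU21 :
    Topology.IsClosedEmbedding fun g : SU21 => (g.1.1 : Matrix (Fin 3) (Fin 3) ℂ) := by
  refine Matrix.SpecialLinearGroup.isClosedEmbedding_val.comp ?_
  refine IsClosed.isClosedEmbedding_subtypeVal ?_
  have : {g : Matrix.SpecialLinearGroup (Fin 3) ℂ | g ∈ SU21} =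
      ⋂ (p : Fin 3 → ℂ) (q : Fin 3 → ℂ), {g | herm (g.1.mulVec p) (g.1.mulVec q) = herm p q} := by
    ext g
    simp only [Set.mem_iInter]
    rfl
  change IsClosed {g : Matrix.SpecialLinearGroup (Fin 3) ℂ | g ∈ SU21}
  rw [this]
  refine isClosed_iInter fun p => isClosed_iInter fun q => isClosed_eq ?_ continuous_const
  exact Continuous.herm (continuous_subtype_val.matrix_mulVec continuous_const)
    (continuous_subtype_val.matrix_mulVec continuous_const)

/-- Flipping the sign of the form along `P` gives the positive definite form `M y ^ 2`. A
stabilizing matrix multiplies `P` by a phase, hence preserves it, and so has bounded entries. -/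
theorem isCompact_stabilizer_SU21 (x : H2) : IsCompact {g : SU21 | (g : PU21) • x = x} := by
  have hP := herm_unitLift x
  set P := unitLift x with hPdef
  obtain ⟨c, n, F⟩ := exists_frame hP
  let M : (Fin 3 → ℂ) → ℝ := fun y => Real.sqrt ((herm y y).re + 2 * Complex.normSq (herm y P))
  have hM : ∀ y, ‖herm y c‖ ≤ M y ∧ ‖herm y n‖ ≤ M y ∧ ‖herm y P‖ ≤ M y := by
    intro y
    have h1 := F.herm_self_re_eq y
    have a1 := Complex.normSq_nonneg (herm y c)
    have a2 := Complex.normSq_nonneg (herm y n)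
    have a3 := Complex.normSq_nonneg (herm y P)
    refine ⟨Real.le_sqrt_of_sq_le ?_, Real.le_sqrt_of_sq_le ?_, Real.le_sqrt_of_sq_le ?_⟩ <;>
    · rw [← Complex.normSq_eq_norm_sq]
      linarith
  have hbound : ∀ y i, ‖y i‖ ≤ M y * (‖c i‖ + ‖n i‖ + ‖P i‖) := by
    intro y i
    obtain ⟨h1, h2, h3⟩ := hM y
    conv_lhs => rw [F.expand y]
    simp only [Pi.sub_apply, Pi.add_apply, Pi.smul_apply, smul_eq_mul]
    refine (norm_sub_le _ _).trans ?_
    refine (add_le_add_left (norm_add_le _ _) _).trans ?_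
    rw [norm_mul, norm_mul, norm_mul, mul_add, mul_add]
    gcongr
  let B : Fin 3 → Fin 3 → ℝ := fun i j =>
    M (Pi.single j 1) * (‖c i‖ + ‖n i‖ + ‖P i‖)
  have hbox : IsCompact (Set.univ.pi fun i => Set.univ.pi fun j =>
      Metric.closedBall (0 : ℂ) (B i j)) :=
    isCompact_univ_pi fun i => isCompact_univ_pi fun j => isCompact_closedBall _ _
  refine (isClosedEmbedding_SU21.isCompact_preimage hbox).of_isClosed_subset ?_ ?_
  · exact isClosed_singleton.preimage
      ((continuous_smul_right x).comp QuotientGroup.continuous_mk)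
  · intro g hg i _ j _
    change (g : PU21) • x = x at hg
    rw [mem_closedBall_zero_iff]
    have hgl : ∃ a : ℂ, g.1.1.mulVec P = a • P := by
      refine ⟨(g.1.1.mulVec (lift x)) 2, ?_⟩
      have h2 := ne_zero_of_neg (mulVec_neg g x)
      have h1 := congrArg lift hg
      rw [mk_smul, lift_proj, inv_smul_eq_iff₀ h2] at h1
      rw [hPdef, unitLift, Matrix.mulVec_smul, h1, smul_comm]
      congr 2
      exact congrFun h1 2
    obtain ⟨a, ha⟩ := hgl
    have hPre : (herm P P).re = -1 := by rw [hP]; simp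
    have hna : Complex.normSq a = 1 := by
      have h1 := congrArg Complex.re (g.2 P P)
      rw [ha, herm_smul_self_re, hPre] at h1
      linarith
    have hMg : ∀ y, M (g.1.1.mulVec y) = M y := by
      intro y
      have h1 : Complex.normSq (herm (g.1.1.mulVec y) P) = Complex.normSq (herm y P) := by
        rw [← g.2 y P, ha, herm_smul_right, map_mul, Complex.star_def, Complex.normSq_conj, hna,
          one_mul]
      simp only [M]
      rw [h1, g.2]
    have := hbound (g.1.1.mulVec (Pi.single j 1)) i
    rw [hMg] at this
    simpa using this

theorem isClosed_scalars : IsClosed (scalars : Set SU21) := by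
  have : (scalars : Set SU21) = ⋂ x : Fin 3 → ℂ,
      {g | g.1.1.mulVec x = (g.1.1 0 0) • x} := by
    ext g
    simp only [Set.mem_iInter]
    constructor
    · rintro ⟨c, hc⟩ x
      have h1 : g.1.1 0 0 = c := by
        have := congrFun (hc (Pi.single 0 1)) 0
        simpa using this
      change g.1.1.mulVec x = _
      rw [h1]
      exact hc x
    · intro h
      exact ⟨_, h⟩
  rw [this]
  have h1 : Continuous fun g : SU21 => g.1.1 := isClosedEmbedding_SU21.continuous
  refine isClosed_iInter fun x => isClosed_eq (h1.matrix_mulVec continuous_const) ?_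
  exact (h1.matrix_elem 0 0).smul continuous_const

instance : T2Space PU21 := by
  have : IsClosed (scalars : Set SU21) := isClosed_scalars
  infer_instance

/-- A discrete group meets the compact stabilizer in a finite set containing all powers of `g`, so
`g` has finite order. -/
theorem IsDiscreteTorsionFree.eq_one_of_smul_eq {Γ : Subgroup PU21}
    (hΓ : IsDiscreteTorsionFree Γ) {g : PU21} (hg : g ∈ Γ) {x : H2} (hx : g • x = x) : g = 1 := by
  have := hΓ.discrete
  have hK : IsCompact {g : PU21 | g • x = x} := by
    convert (isCompact_stabilizer_SU21 x).image QuotientGroup.continuous_mk using 1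
    ext g
    constructor
    · intro hg
      obtain ⟨g', rfl⟩ := QuotientGroup.mk_surjective g
      exact ⟨g', hg, rfl⟩
    · rintro ⟨g', hg', rfl⟩
      exact hg'
  have hfin : ((Γ : Set PU21) ∩ {g : PU21 | g • x = x}).Finite := by
    refine IsCompact.finite (hK.inter_left Subgroup.isClosed_of_discrete) ?_
    have : IsDiscrete (Γ : Set PU21) := ⟨hΓ.discrete⟩
    exact this.mono Set.inter_subset_left
  refine hΓ.torsionFree g hg ?_
  by_contra hinf
  have hinj := injective_pow_iff_not_isOfFinOrder.2 hinf
  refine Set.infinite_range_of_injective hinj (hfin.subset ?_)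
  rintro _ ⟨k, rfl⟩
  refine ⟨pow_mem hg k, ?_⟩
  change g ^ k • x = x
  induction k with
  | zero => simp
  | succ k ih => rw [pow_succ, mul_smul, hx, ih]

/-! ### Points on geodesics and perpendicularity -/

theorem det3_smul_left (a : ℂ) (x y z : Fin 3 → ℂ) : det3 (a • x) y z = a * det3 x y z := by
  simp only [det3, Pi.smul_apply, smul_eq_mul]; ring

theorem det3_cycle (x y z : Fin 3 → ℂ) : det3 x y z = det3 y z x := by
  simp only [det3]; ring

theorem det3_swap (x y z : Fin 3 → ℂ) : det3 x y z = -det3 y x z := by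
  simp only [det3]; ring

/-- The equality case of the triangle inequality: lifts of collinear points are dependent. -/
theorem det3_eq_zero_of_rho_add_eq {x y z : H2} (h : rho x z + rho z y = rho x y) :
    det3 (lift x) (lift y) (lift z) = 0 := by
  obtain ⟨X, Y, a, b, ha, hb, hXa, hYb, hX, hY, hXY⟩ := exists_aligned_lifts x y
  have hZ := herm_unitLift z
  set Z := unitLift z with hZdef
  have hx' : lift x = a⁻¹ • X := by rw [hXa, inv_smul_smul₀ ha]
  have hy' : lift y = b⁻¹ • Y := by rw [hYb, inv_smul_smul₀ hb]
  have hz' : lift z = (((Real.sqrt (-(herm (lift z) (lift z)).re))⁻¹ : ℝ) : ℂ)⁻¹ • Z := by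
    rw [hZdef, unitLift, inv_smul_smul₀ (unitLift_scale_ne_zero z)]
  have key : det3 X Y Z = 0 := by
    have kXZ : Complex.normSq (herm X Z) = Real.cosh (rho x z / 2) ^ 2 := by
      rw [cosh_sq_half_rho, hx', hz', kappa_smul_left (inv_ne_zero ha),
        kappa_smul_right (inv_ne_zero (unitLift_scale_ne_zero z)), kappa, hX, hZ]
      simp
    have kZY : Complex.normSq (herm Z Y) = Real.cosh (rho z y / 2) ^ 2 := by
      rw [cosh_sq_half_rho, hy', hz', kappa_smul_right (inv_ne_zero hb),
        kappa_smul_left (inv_ne_zero (unitLift_scale_ne_zero z)), kappa, hY, hZ]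
      simp
    set α := rho x z / 2
    set β := rho z y / 2
    have hαβ : rho x y / 2 = α + β := by simp only [α, β]; rw [← h]; ring
    obtain ⟨C, hC⟩ : ∃ C, C = Real.cosh (α + β) := ⟨_, rfl⟩
    rw [hαβ, ← hC] at hXY
    have hYX : herm Y X = -(C : ℂ) := by
      rw [← star_herm, hXY, star_neg, Complex.star_def, Complex.conj_ofReal]
    have hre : (herm X Z * herm Z Y).re ≤ Real.cosh α * Real.cosh β := by
      refine (Complex.re_le_norm _).trans ?_
      rw [norm_mul]
      refine le_of_eq ?_
      congr 1
      · rw [Complex.normSq_eq_norm_sq] at kXZ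
        exact (pow_left_inj₀ (norm_nonneg _) (Real.cosh_pos _).le two_ne_zero).1 kXZ
      · rw [Complex.normSq_eq_norm_sq] at kZY
        exact (pow_left_inj₀ (norm_nonneg _) (Real.cosh_pos _).le two_ne_zero).1 kZY
    -- The squared determinant increases with the real part of `⟨X,Z⟩⟨Z,Y⟩`. That real part is at
    -- most `cosh α * cosh β`, and at this extreme value the expression vanishes (`hid`).
    have hgram := gram_det X Z Y
    rw [hX, hY, hZ, hXY, hYX] at hgram
    have e1 : herm X Z * herm Z X = (Complex.normSq (herm X Z) : ℂ) := herm_mul_herm _ _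
    have e2 : herm Z Y * herm Y Z = (Complex.normSq (herm Z Y) : ℂ) := herm_mul_herm _ _
    have e3 : herm Z X * herm Y Z = star (herm X Z * herm Z Y) := by
      rw [star_mul, star_herm, star_herm, mul_comm]
    have e4 : det3 X Z Y * star (det3 X Z Y) = (Complex.normSq (det3 X Z Y) : ℂ) := by
      rw [Complex.star_def, Complex.mul_conj]
    have hg : ((-1 - 2 * C * (herm X Z * herm Z Y).re
        + Real.cosh α ^ 2 + Real.cosh β ^ 2 + C ^ 2 : ℝ) : ℂ)
        = ((-Complex.normSq (det3 X Z Y) : ℝ) : ℂ) := by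
      have e5 : herm X Z * herm Z Y + star (herm X Z * herm Z Y)
          = ((2 * (herm X Z * herm Z Y).re : ℝ) : ℂ) := by
        rw [Complex.star_def, Complex.add_conj]
      rw [← kXZ, ← kZY]
      push_cast at e5 ⊢
      rw [← e1, ← e2, ← e4]
      rw [← e3] at e5
      linear_combination hgram + (C : ℂ) * e5
    have hg' := Complex.ofReal_injective hg
    have hc := hC.trans (Real.cosh_add α β)
    have hsα := Real.cosh_sq α
    have hsβ := Real.cosh_sq β
    have hpos : 0 < C := hC ▸ Real.cosh_pos (α + β)
    have hid : -1 - 2 * C * (Real.cosh α * Real.cosh β)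
        + Real.cosh α ^ 2 + Real.cosh β ^ 2 + C ^ 2 = 0 := by
      rw [hc]
      linear_combination (1 - Real.cosh β ^ 2) * hsα - Real.sinh α ^ 2 * hsβ
    have hle : Complex.normSq (det3 X Z Y) ≤ 0 := by nlinarith
    have h0 := Complex.normSq_eq_zero.1 (le_antisymm hle (Complex.normSq_nonneg _))
    rw [det3_cycle, det3_swap, det3_cycle, det3_cycle, h0, neg_zero]
  rw [hx', hy', hz', det3_smul_left, det3_cycle, det3_smul_left, det3_cycle, det3_smul_left,
    det3_cycle, key]
  simp

/-- The vector of `ℂ³` of a tangent vector of the ball. -/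
def tlift (v : ℂ × ℂ) : Fin 3 → ℂ := ![v.1, v.2, 0]

theorem lift_sub (p q : H2) : lift p - lift q = tlift ((p : ℂ × ℂ) - q) := by
  funext i
  fin_cases i <;> simp [lift, tlift]

/-- The determinant with the two endpoint lifts is affine in the third point and zero along the
geodesic, so its linear part `T` kills the velocity. -/
theorem det3_tlift_eq_zero {ℓ : ℝ} (hℓ : 0 < ℓ) {δ : ℝ → H2} (hδ : IsGeodesicSegment ℓ δ) {t : ℝ}
    (ht : t ∈ Set.Icc 0 ℓ) {v : ℂ × ℂ}
    (hv : HasDerivWithinAt (fun s => (δ s : ℂ × ℂ)) v (Set.Icc 0 ℓ) t) :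
    det3 (lift (δ 0)) (lift (δ ℓ)) (tlift v) = 0 := by
  have hz : ∀ s ∈ Set.Icc 0 ℓ, det3 (lift (δ 0)) (lift (δ ℓ)) (lift (δ s)) = 0 := by
    intro s hs
    apply det3_eq_zero_of_rho_add_eq
    have h0 : (0 : ℝ) ∈ Set.Icc 0 ℓ := ⟨le_rfl, hℓ.le⟩
    have h1 : ℓ ∈ Set.Icc 0 ℓ := ⟨hℓ.le, le_rfl⟩
    rw [hδ 0 h0 s hs, hδ s hs ℓ h1, hδ 0 h0 ℓ h1, zero_sub, zero_sub, abs_neg, abs_neg,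
      abs_sub_comm, abs_of_nonneg hs.1, abs_of_nonneg (sub_nonneg.2 hs.2), abs_of_pos hℓ]
    ring
  let T : ℂ × ℂ →L[ℝ] ℂ :=
    (lift (δ 0) 1 * lift (δ ℓ) 2 - lift (δ 0) 2 * lift (δ ℓ) 1) • ContinuousLinearMap.fst ℝ ℂ ℂ +
    (lift (δ 0) 2 * lift (δ ℓ) 0 - lift (δ 0) 0 * lift (δ ℓ) 2) • ContinuousLinearMap.snd ℝ ℂ ℂ
  have hT : ∀ w, det3 (lift (δ 0)) (lift (δ ℓ)) (tlift w) = T w := by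
    intro w
    simp only [T, det3, tlift, _root_.add_apply, _root_.smul_apply,
      ContinuousLinearMap.coe_fst', ContinuousLinearMap.coe_snd', smul_eq_mul,
      Matrix.cons_val_zero, Matrix.cons_val_one, Matrix.cons_val]
    ring
  have hTl : ∀ p : H2, T (p : ℂ × ℂ) = det3 (lift (δ 0)) (lift (δ ℓ)) (lift p)
      - (lift (δ 0) 0 * lift (δ ℓ) 1 - lift (δ 0) 1 * lift (δ ℓ) 0) := by
    intro p
    rw [← hT]
    simp only [det3, tlift, lift, Matrix.cons_val_zero, Matrix.cons_val_one, Matrix.cons_val]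
    ring
  have hd := T.hasFDerivAt.comp_hasDerivWithinAt t hv
  have hc : HasDerivWithinAt (T ∘ fun s => (δ s : ℂ × ℂ)) 0 (Set.Icc 0 ℓ) t := by
    refine (hasDerivWithinAt_const t (Set.Icc 0 ℓ)
      (0 - (lift (δ 0) 0 * lift (δ ℓ) 1 - lift (δ 0) 1 * lift (δ ℓ) 0))).congr_of_mem ?_ ht
    intro s hs
    simp only [Function.comp_apply]
    rw [hTl, hz s hs]
  rw [hT]
  exact (uniqueDiffOn_Icc hℓ t ht).eq_deriv _ hd hc

/-- Without this, perpendicularity could hold vacuously. The quadratic quantity `Φ` equals `sinh²(|s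
- t|/2)` times a product of norms on the chord `δ s - δ t`. Unit speed thus bounds it below on
slopes by a quantity with positive limit, whereas it would tend to `0` if the slopes did. -/
theorem velocity_ne_zero {ℓ : ℝ} (hℓ : 0 < ℓ) {δ : ℝ → H2} (hδ : IsGeodesicSegment ℓ δ) {t : ℝ}
    (ht : t ∈ Set.Icc 0 ℓ) {v : ℂ × ℂ}
    (hv : HasDerivWithinAt (fun s => (δ s : ℂ × ℂ)) v (Set.Icc 0 ℓ) t) : v ≠ 0 := by
  rintro rfl
  set E := lift (δ t) with hE
  have hEneg := herm_lift_neg (δ t)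
  have hslope := hasDerivWithinAt_iff_tendsto_slope.1 hv
  have hne : (nhdsWithin t (Set.Icc 0 ℓ \ {t})).NeBot :=
    accPt_principal_iff_nhdsWithin.1 (uniqueDiffOn_Icc hℓ t ht).accPt
  let Φ : ℂ × ℂ → ℝ := fun w => (herm (hcross (tlift w) E) (hcross (tlift w) E)).re
  have hΦc : Continuous Φ := by
    simp only [Φ, herm, hcross, tlift, Matrix.cons_val_zero, Matrix.cons_val_one, Matrix.cons_val]
    fun_prop
  have hΦ0 : Φ 0 = 0 := by
    simp [Φ, herm, hcross, tlift]
  have hΦsmul : ∀ (r : ℝ) (w : ℂ × ℂ), Φ (r • w) = r ^ 2 * Φ w := by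
    intro r w
    have : hcross (tlift (r • w)) E = (r : ℂ) • hcross (tlift w) E := by
      funext i
      fin_cases i <;> simp [hcross, tlift] <;> ring
    simp only [Φ]
    rw [this, herm_smul_self_re, Complex.normSq_ofReal]
    ring
  have hlim1 : Filter.Tendsto (fun s => Φ (slope (fun s => (δ s : ℂ × ℂ)) t s))
      (nhdsWithin t (Set.Icc 0 ℓ \ {t})) (nhds 0) := by
    have := (hΦc.tendsto 0).comp hslope
    rwa [hΦ0] at this
  have hδc : Filter.Tendsto (fun s => (δ s : ℂ × ℂ)) (nhdsWithin t (Set.Icc 0 ℓ \ {t}))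
      (nhds (δ t : ℂ × ℂ)) :=
    hv.continuousWithinAt.tendsto.mono_left (nhdsWithin_mono _ Set.sdiff_subset)
  have hδc' : Filter.Tendsto δ (nhdsWithin t (Set.Icc 0 ℓ \ {t})) (nhds (δ t)) :=
    tendsto_subtype_rng.2 hδc
  have hlim2 : Filter.Tendsto (fun s => (herm (lift (δ s)) (lift (δ s))).re * (herm E E).re / 4)
      (nhdsWithin t (Set.Icc 0 ℓ \ {t})) (nhds ((herm E E).re * (herm E E).re / 4)) := by
    have hcont : Continuous fun p : H2 => (herm (lift p) (lift p)).re * (herm E E).re / 4 :=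
      ((Complex.continuous_re.comp (Continuous.herm continuous_lift continuous_lift)).mul
        continuous_const).div_const _
    exact (hcont.tendsto (δ t)).comp hδc'
  have hle : (herm E E).re * (herm E E).re / 4 ≤ 0 := by
    refine le_of_tendsto_of_tendsto hlim2 hlim1 ?_
    filter_upwards [self_mem_nhdsWithin] with s hs
    have hst : s - t ≠ 0 := sub_ne_zero.2 hs.2
    have hsneg := herm_lift_neg (δ s)
    have hk : Φ ((δ s : ℂ × ℂ) - δ t) = (kappa (lift (δ s)) E - 1) *
        ((herm (lift (δ s)) (lift (δ s))).re * (herm E E).re) := by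
      have hcr : hcross (tlift ((δ s : ℂ × ℂ) - δ t)) E = hcross (lift (δ s)) E := by
        rw [← lift_sub, ← hE]
        funext i
        fin_cases i <;> simp [hcross] <;> ring
      simp only [Φ]
      rw [hcr, herm_hcross_self, herm_mul_herm, herm_self (lift (δ s)), herm_self E, kappa,
        ← Complex.ofReal_mul, ← Complex.ofReal_sub, Complex.ofReal_re, Complex.ofReal_re,
        Complex.ofReal_re, sub_mul, div_mul_cancel₀ _ (mul_ne_zero hsneg.ne hEneg.ne), one_mul]
    have hsl : Φ (slope (fun s => (δ s : ℂ × ℂ)) t s) =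
        ((s - t)⁻¹) ^ 2 * Φ ((δ s : ℂ × ℂ) - δ t) := by
      rw [slope_def_module, hΦsmul]
    rw [hsl, hk, ← sinh_sq_half_rho, hδ s hs.1 t ht]
    have h1 : |s - t| / 2 ≤ Real.sinh (|s - t| / 2) := Real.self_le_sinh_iff.2 (by positivity)
    have h2 : (s - t) ^ 2 / 4 ≤ Real.sinh (|s - t| / 2) ^ 2 := by
      have := pow_le_pow_left₀ (by positivity) h1 2
      rw [div_pow, sq_abs] at this
      linarith
    have hD := mul_pos_of_neg_of_neg hsneg hEneg
    calc _ = ((s - t)⁻¹) ^ 2 * ((s - t) ^ 2 / 4 *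
          ((herm (lift (δ s)) (lift (δ s))).re * (herm E E).re)) := by
            field_simp
      _ ≤ _ := by gcongr
  have := mul_pos_of_neg_of_neg hEneg hEneg
  linarith

theorem mem_tangentConeAt_line {n : Fin 3 → ℂ} {e : H2} (he : herm (lift e) n = 0) {w : ℂ × ℂ}
    (hw : herm (tlift w) n = 0) :
    w ∈ tangentConeAt ℝ ((fun x : H2 => (x : ℂ × ℂ)) '' {p | herm (lift p) n = 0})
      (e : ℂ × ℂ) := by
  refine mem_tangentConeAt_of_pow_smul (r := (1 / 2 : ℝ)) (by norm_num) (by norm_num) ?_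
  have hopen : IsOpen {p : ℂ × ℂ | ‖p.1‖ ^ 2 + ‖p.2‖ ^ 2 < 1} :=
    isOpen_lt (by fun_prop) continuous_const
  have hlim : Filter.Tendsto (fun k : ℕ => (e : ℂ × ℂ) + (1 / 2 : ℝ) ^ k • w) Filter.atTop
      (nhds ((e : ℂ × ℂ) + (0 : ℝ) • w)) :=
    tendsto_const_nhds.add ((tendsto_pow_atTop_nhds_zero_of_lt_one (by norm_num)
      (by norm_num)).smul_const w)
  rw [zero_smul, add_zero] at hlim
  filter_upwards [hlim.eventually (hopen.mem_nhds e.2)] with k hk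
  refine ⟨⟨_, hk⟩, ?_, rfl⟩
  have : lift ⟨(e : ℂ × ℂ) + (1 / 2 : ℝ) ^ k • w, hk⟩ =
      lift e + (((1 / 2 : ℝ) ^ k : ℝ) : ℂ) • tlift w := by
    funext i
    fin_cases i <;> simp [lift, tlift]
  change herm (lift _) n = 0
  rw [this, herm_add_left, herm_smul_left, he, hw]
  simp

/-- The determinant is `⟨v, W⟩`, with `W` orthogonal to `lift e` and `n`, thus spanning the tangent
direction of the line. Its multiples by `1` and `I` give the real and imaginary parts. -/
theorem det3_eq_zero_of_perp {n : Fin 3 → ℂ} {e : H2} (he : herm (lift e) n = 0) {v : ℂ × ℂ}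
    (hv : ∀ w ∈ tangentConeAt ℝ ((fun x : H2 => (x : ℂ × ℂ)) '' {p | herm (lift p) n = 0})
      (e : ℂ × ℂ), bergman e v w = 0) :
    det3 (tlift v) (lift e) n = 0 := by
  rw [← herm_hcross]
  set W := hcross (lift e) n with hW
  have hWe : herm (lift e) W = 0 := by
    rw [hW, herm_hcross, det3]; ring
  have hWn : herm W n = 0 := by
    rw [herm_eq_zero_comm, hW, herm_hcross, det3]; ring
  have hneg := herm_lift_neg (e)
  have key : ∀ a : ℂ, (star a * herm (tlift v) W).re = 0 := by
    intro a
    -- A multiple of `lift e` is subtracted to make the last coordinate zero; it does not change the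
    -- Bergman product.
    let w : ℂ × ℂ := (a * (W 0 - W 2 * lift e 0), a * (W 1 - W 2 * lift e 1))
    have hw : tlift w = a • (W - W 2 • lift e) := by
      funext i
      fin_cases i
      · rfl
      · rfl
      · change (0 : ℂ) = a * (W 2 - W 2 * 1)
        ring
    have h1 := hv w (mem_tangentConeAt_line he (by
      rw [hw, herm_smul_left, herm_sub_left, herm_smul_left, hWn, he]; simp))
    rw [bergman] at h1
    change -4 * ((herm (lift e) (lift e) * herm (tlift v) (tlift w)
      - herm (tlift v) (lift e) * herm (lift e) (tlift w)) / (herm (lift e) (lift e)) ^ 2).re = 0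
      at h1
    have h2 : herm (lift e) (lift e) * herm (tlift v) (tlift w)
      - herm (tlift v) (lift e) * herm (lift e) (tlift w)
      = herm (lift e) (lift e) * (star a * herm (tlift v) W) := by
      rw [hw, herm_smul_right, herm_smul_right, herm_sub_right, herm_sub_right, herm_smul_right,
        herm_smul_right, hWe]
      ring
    have h3 : herm (lift e) (lift e) ≠ 0 := fun h => by rw [h] at hneg; simp at hneg
    rw [h2, sq, mul_div_mul_left _ _ h3, herm_self, Complex.div_ofReal_re] at h1
    have h4 : (star a * herm (tlift v) W).re / (herm (lift e) (lift e)).re = 0 := by linarith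
    exact (div_eq_zero_iff.1 h4).resolve_right hneg.ne
  apply Complex.ext
  · simpa using key 1
  · simpa using key Complex.I

theorem tlift_ne_zero {v : ℂ × ℂ} (hv : v ≠ 0) : tlift v ≠ 0 := by
  intro h
  apply hv
  have h0 := congrFun h 0
  have h1 := congrFun h 1
  exact Prod.ext (by simpa [tlift] using h0) (by simpa [tlift] using h1)

theorem det3_smul_eq (P Q n v : Fin 3 → ℂ) :
    det3 P Q n • v = det3 v Q n • P + det3 P v n • Q + det3 P Q v • n := by
  funext i
  fin_cases i <;> simp [det3] <;> ring

/-- Both polar vectors lie in the complex plane of `ℂ³` spanned by the lifts of the endpoints,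
because the nonzero velocity is in that plane and is also dependent on the endpoint and its polar
vector. -/
theorem IsOrthogeodesicEndpoints.det3_eq_zero {n₁ n₂ : Fin 3 → ℂ} {p₁ p₂ : H2}
    (h : IsOrthogeodesicEndpoints {p | herm (lift p) n₁ = 0} {p | herm (lift p) n₂ = 0} p₁ p₂) :
    0 < rho p₁ p₂ ∧ det3 (lift p₁) (lift p₂) n₁ = 0 ∧ det3 (lift p₁) (lift p₂) n₂ = 0 := by
  obtain ⟨hp₁, hp₂, ℓ, δ, hℓ, rfl, rfl, hδ, ⟨v, hv, hvp⟩, ⟨w, hw, hwp⟩⟩ := h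
  have h0 : (0 : ℝ) ∈ Set.Icc 0 ℓ := ⟨le_rfl, hℓ.le⟩
  have h1 : ℓ ∈ Set.Icc 0 ℓ := ⟨hℓ.le, le_rfl⟩
  refine ⟨?_, ?_, ?_⟩
  · rw [hδ 0 h0 ℓ h1, zero_sub, abs_neg, abs_of_pos hℓ]
    exact hℓ
  · have d1 := det3_tlift_eq_zero hℓ hδ h0 hv
    have d2 := det3_eq_zero_of_perp hp₁ hvp
    have hv0 := tlift_ne_zero (velocity_ne_zero hℓ hδ h0 hv)
    have d3 := det3_smul_eq (lift (δ 0)) (lift (δ ℓ)) n₁ (tlift v)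
    rw [det3_swap] at d2
    rw [d1, neg_eq_zero.1 d2, zero_smul, zero_smul, add_zero, add_zero] at d3
    -- Compare last coordinates: zero for a tangent vector, one for a lift.
    have d4 : det3 (tlift v) (lift (δ ℓ)) n₁ = 0 := by
      have := congrFun d3 2
      simpa [tlift, lift] using this.symm
    rw [d4, zero_smul] at d3
    exact (smul_eq_zero.1 d3).resolve_right hv0
  · have d1 := det3_tlift_eq_zero hℓ hδ h1 hw
    have d2 := det3_eq_zero_of_perp hp₂ hwp
    have hw0 := tlift_ne_zero (velocity_ne_zero hℓ hδ h1 hw)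
    have d3 := det3_smul_eq (lift (δ 0)) (lift (δ ℓ)) n₂ (tlift w)
    rw [d1, d2, zero_smul, zero_smul, add_zero, zero_add] at d3
    have d4 : det3 (lift (δ 0)) (tlift w) n₂ = 0 := by
      have := congrFun d3 2
      simpa [tlift, lift] using this.symm
    rw [d4, zero_smul] at d3
    exact (smul_eq_zero.1 d3).resolve_right hw0

/-! ### A pair of frames adapted to two complex lines with a common perpendicular -/

theorem polar_smul {k : ℂ} (hk : k ≠ 0) (n : Fin 3 → ℂ) :
    {p : H2 | herm (lift p) (k • n) = 0} = {p | herm (lift p) n = 0} := by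
  ext p
  change herm (lift p) (k • n) = 0 ↔ herm (lift p) n = 0
  rw [herm_smul_right, mul_eq_zero]
  simp [hk]

theorem IsOrthogeodesicEndpoints.exists_frames {L₁ L₂ : Set H2} {p₁ p₂ : H2}
    (hL₁ : IsComplexLine L₁) (hL₂ : IsComplexLine L₂)
    (h : IsOrthogeodesicEndpoints L₁ L₂ p₁ p₂) :
    ∃ c N₁ P₁ N₂ P₂ : Fin 3 → ℂ, IsFrame c N₁ P₁ ∧ IsFrame c N₂ P₂ ∧
      L₁ = {p | herm (lift p) N₁ = 0} ∧ L₂ = {p | herm (lift p) N₂ = 0} ∧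
      (∃ a : ℂ, a ≠ 0 ∧ P₁ = a • lift p₁) ∧ (∃ a : ℂ, a ≠ 0 ∧ P₂ = a • lift p₂) ∧
      P₂ = (Real.cosh (rho p₁ p₂ / 2) : ℂ) • P₁ + (Real.sinh (rho p₁ p₂ / 2) : ℂ) • N₁ := by
  obtain ⟨n₁, hn₁, rfl⟩ := hL₁
  obtain ⟨n₂, hn₂, rfl⟩ := hL₂
  have hp₁ : herm (lift p₁) n₁ = 0 := h.1
  have hp₂ : herm (lift p₂) n₂ = 0 := h.2.1
  obtain ⟨hpos, hd₁, hd₂⟩ := h.det3_eq_zero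
  obtain ⟨X, Y, a, b, ha, hb, hXa, hYb, hX, hY, hXY⟩ := exists_aligned_lifts p₁ p₂
  have hshpos : 0 < Real.sinh (rho p₁ p₂ / 2) := Real.sinh_pos_iff.2 (half_pos hpos)
  have hcs := Real.cosh_sq (rho p₁ p₂ / 2)
  generalize Real.cosh (rho p₁ p₂ / 2) = C at *
  generalize Real.sinh (rho p₁ p₂ / 2) = S at *
  have hS0 : (S : ℂ) ≠ 0 := by exact_mod_cast hshpos.ne'
  have hcsC : (C : ℂ) ^ 2 = (S : ℂ) ^ 2 + 1 := by exact_mod_cast hcs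
  have hYX : herm Y X = -(C : ℂ) := by
    rw [← star_herm, hXY, star_neg, Complex.star_def, Complex.conj_ofReal]
  obtain ⟨k, hk, hkn⟩ := exists_unit_smul hn₁
  have hkX : herm (k • n₁) X = 0 := by
    rw [herm_eq_zero_comm, hXa, herm_smul_left, herm_smul_right, hp₁]
    simp
  have F₀ := IsFrame.of_pair hkn hX hkX
  have hYc : herm Y (hcross X (k • n₁)) = 0 := by
    have h1 : det3 (b • lift p₂) (a • lift p₁) (k • n₁) =
        -(a * b * k) * det3 (lift p₁) (lift p₂) n₁ := by
      simp only [det3, Pi.smul_apply, smul_eq_mul]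
      ring
    rw [herm_hcross, hYb, hXa, h1, hd₁, mul_zero]
  set z := herm Y (k • n₁) with hz
  have hzz : Complex.normSq z = S ^ 2 := by
    have h1 := F₀.herm_self_re_eq Y
    rw [hYc, hY, hYX, ← hz] at h1
    simp only [map_zero, Complex.normSq_neg, Complex.normSq_ofReal, Complex.neg_re,
      Complex.one_re] at h1
    linarith
  have hzz' : z * star z = (S : ℂ) ^ 2 := by
    rw [Complex.star_def, Complex.mul_conj, hzz]; push_cast; ring
  have hz0 : z ≠ 0 := by
    intro h0
    rw [h0, zero_mul] at hzz'
    exact hS0 (pow_eq_zero_iff two_ne_zero |>.1 hzz'.symm)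
  have hstar : star (z / (S : ℂ)) = star z / (S : ℂ) := by
    rw [star_div₀, Complex.star_def, Complex.conj_ofReal]
  -- The phase makes `⟨Y, N⟩` the positive real number `S`.
  set N := (z / (S : ℂ)) • (k • n₁) with hN
  have hNN : herm N N = 1 := by
    rw [hN, herm_smul_left, herm_smul_right, hkn, hstar]
    field_simp
    linear_combination hzz'
  have hNX : herm N X = 0 := by rw [hN, herm_smul_left, hkX, mul_zero]
  have F := IsFrame.of_pair hNN hX hNX
  have hYc' : herm Y (hcross X N) = 0 := by
    have : hcross X N = star (z / (S : ℂ)) • hcross X (k • n₁) := by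
      funext i
      fin_cases i <;> simp [hcross, hN] <;> ring
    rw [this, herm_smul_right, hYc, mul_zero]
  have hYN : herm Y N = S := by
    rw [hN, herm_smul_right, ← hz, hstar]
    field_simp
    linear_combination hzz'
  have hYeq : Y = (C : ℂ) • X + (S : ℂ) • N := by
    rw [F.expand Y, hYc', hYN, hYX]
    module
  -- `(M, Y)` is the boost of `(N, X)` in the plane orthogonal to `c`. The second polar vector lies
  -- in this plane and is orthogonal to `Y`, so it is a multiple of `M`.
  have hframe : ∀ M, M = (S : ℂ) • X + (C : ℂ) • N → IsFrame (hcross X N) M Y := by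
    rintro M rfl
    have hsC : star (C : ℂ) = C := by rw [Complex.star_def, Complex.conj_ofReal]
    have hsS : star (S : ℂ) = S := by rw [Complex.star_def, Complex.conj_ofReal]
    refine ⟨F.cc, ?_, hY, ?_, herm_eq_zero_comm.1 hYc', ?_⟩
    · simp only [herm_add_left, herm_add_right, herm_smul_left, herm_smul_right, hX, hNN, hNX,
        F.Pn, hsC, hsS]
      linear_combination hcsC
    · simp only [herm_add_right, herm_smul_right, F.cn, F.cP]
      ring
    · rw [hYeq]
      simp only [herm_add_left, herm_add_right, herm_smul_left, herm_smul_right, hX, hNN, hNX,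
        F.Pn, hsC, hsS]
      ring
  have F₂ := hframe _ rfl
  set M := (S : ℂ) • X + (C : ℂ) • N with hM
  have hn₂Y : herm n₂ Y = 0 := by
    rw [herm_eq_zero_comm, hYb, herm_smul_left, hp₂, mul_zero]
  have hn₂c : herm n₂ (hcross X N) = 0 := by
    have h1 : det3 n₂ X Y = 0 := by
      rw [det3_cycle, hXa, hYb, det3_smul_left, det3_cycle, det3_smul_left, det3_cycle,
        det3_cycle, hd₂]
      simp
    have h2 : det3 n₂ X Y = (S : ℂ) * det3 n₂ X N := by
      rw [hYeq]
      simp only [det3, Pi.add_apply, Pi.smul_apply, smul_eq_mul]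
      ring
    rw [h2] at h1
    rw [herm_hcross]
    exact (mul_eq_zero.1 h1).resolve_left hS0
  have hn₂M : n₂ = herm n₂ M • M := by
    have := F₂.expand n₂
    rw [hn₂c, hn₂Y, zero_smul, zero_smul, zero_add, sub_zero] at this
    exact this
  have hm0 : herm n₂ M ≠ 0 := by
    intro h0
    rw [h0, zero_smul] at hn₂M
    rw [hn₂M] at hn₂
    simp [herm] at hn₂
  refine ⟨_, N, X, M, Y, F, F₂, ?_, ?_, ⟨a, ha, hXa⟩, ⟨b, hb, hYb⟩, hYeq⟩
  · rw [hN, polar_smul (div_ne_zero hz0 hS0), polar_smul hk]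
  · conv_lhs => rw [hn₂M]
    exact polar_smul hm0 M

/-! ### The orthogonal projections in an orthonormal frame -/

/-- Data attached to a complex line and a point on it: an orthonormal frame `(c, n, P)` such that
`n` is polar to the line and `P` is a lift of the point. -/
structure LineFrame (L : Set H2) (p : H2) (c n P : Fin 3 → ℂ) : Prop extends IsFrame c n P where
  line : L = {x | herm (lift x) n = 0}
  point : ∃ a : ℂ, a ≠ 0 ∧ P = a • lift p

/-- The distance to `p` of the orthogonal projection of `x` to the complex line through `p` with
polar vector `c`, in a frame `(c, n, P)` where `P` is a lift of `p`. -/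
noncomputable def axisDist (n P : Fin 3 → ℂ) (x : H2) : ℝ :=
  2 * Real.arsinh (Real.sqrt (Complex.normSq (herm (lift x) n) /
    (Complex.normSq (herm (lift x) P) - Complex.normSq (herm (lift x) n))))

theorem axisDist_nonneg (n P : Fin 3 → ℂ) (x : H2) : 0 ≤ axisDist n P x := by
  have := Real.arsinh_nonneg_iff.2 (Real.sqrt_nonneg (Complex.normSq (herm (lift x) n) /
    (Complex.normSq (herm (lift x) P) - Complex.normSq (herm (lift x) n))))
  rw [axisDist]
  linarith

namespace LineFrame

variable {L : Set H2} {p : H2} {c n P : Fin 3 → ℂ} (F : LineFrame L p c n P)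
include F

theorem normSq_add_lt (x : H2) : Complex.normSq (herm (lift x) c) +
    Complex.normSq (herm (lift x) n) < Complex.normSq (herm (lift x) P) := by
  have := F.herm_self_re_eq (lift x)
  linarith [herm_lift_neg x]

theorem axis_pos (x : H2) :
    0 < Complex.normSq (herm (lift x) P) - Complex.normSq (herm (lift x) n) := by
  linarith [F.normSq_add_lt x, Complex.normSq_nonneg (herm (lift x) c)]

theorem sinh_sq_axisDist (x : H2) : Real.sinh (axisDist n P x / 2) ^ 2 =
    Complex.normSq (herm (lift x) n) /
      (Complex.normSq (herm (lift x) P) - Complex.normSq (herm (lift x) n)) := by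
  rw [axisDist, mul_div_cancel_left₀ _ two_ne_zero, Real.sinh_arsinh,
    Real.sq_sqrt (div_nonneg (Complex.normSq_nonneg _) (F.axis_pos x).le)]

theorem cosh_sq_axisDist (x : H2) : Real.cosh (axisDist n P x / 2) ^ 2 =
    Complex.normSq (herm (lift x) P) /
      (Complex.normSq (herm (lift x) P) - Complex.normSq (herm (lift x) n)) := by
  have := (F.axis_pos x).ne'
  rw [Real.cosh_sq, F.sinh_sq_axisDist]
  field_simp
  ring

theorem mem_line : p ∈ L := by
  obtain ⟨a, ha, hP⟩ := F.point
  rw [F.line]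
  have := F.Pn
  rw [hP, herm_smul_left, mul_eq_zero] at this
  exact this.resolve_left ha

theorem herm_line {x : H2} (hx : x ∈ L) : herm (lift x) n = 0 := by
  rw [F.line] at hx
  exact hx

theorem proj_neg (x : H2) : (herm (lift x - herm (lift x) n • n)
    (lift x - herm (lift x) n • n)).re < 0 := by
  have h := sub_smul_herm_self_re (v := n) (w := lift x) (by rw [F.nn]; simp)
  rw [F.nn, div_one] at h
  rw [h]
  simp only [Complex.one_re, div_one]
  linarith [herm_lift_neg x, Complex.normSq_nonneg (herm (lift x) n)]

theorem proj_re (x : H2) : (herm (lift x - herm (lift x) n • n)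
    (lift x - herm (lift x) n • n)).re =
      Complex.normSq (herm (lift x) c) - Complex.normSq (herm (lift x) P) := by
  have h := sub_smul_herm_self_re (v := n) (w := lift x) (by rw [F.nn]; simp)
  rw [F.nn, div_one] at h
  rw [h, F.herm_self_re_eq (lift x), Complex.one_re, div_one]
  ring

/-- Reverse Cauchy-Schwarz against the projection of `y` to the line bounds `sinh²` of half the
distance below by `|⟨y,n⟩|² / (-⟨y,y⟩)`. Dropping the `c`-component enlarges the denominator. -/
theorem axisDist_le_rho {x : H2} (hx : x ∈ L) (y : H2) : axisDist n P y ≤ rho x y := by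
  apply le_rho_of_sinh_sq_le
  rw [F.sinh_sq_axisDist]
  have hxn := F.herm_line hx
  have hw := F.proj_re y
  have h1 := mul_le_normSq_herm (v := lift x) (w := lift y - herm (lift y) n • n)
    (herm_lift_neg x)
  rw [hw, herm_sub_right _ (lift y), herm_smul_right, hxn, mul_zero, sub_zero] at h1
  have hy := F.herm_self_re_eq (lift y)
  have hxneg := herm_lift_neg x
  have hyneg := herm_lift_neg y
  have hpos := F.axis_pos y
  have hB := Complex.normSq_nonneg (herm (lift y) n)
  have hA := Complex.normSq_nonneg (herm (lift y) c)
  have h2 : Complex.normSq (herm (lift y) n) / -(herm (lift y) (lift y)).re ≤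
      kappa (lift x) (lift y) - 1 := by
    have h3 : kappa (lift x) (lift y) - 1 -
        Complex.normSq (herm (lift y) n) / -(herm (lift y) (lift y)).re
        = (Complex.normSq (herm (lift x) (lift y)) - (herm (lift x) (lift x)).re *
          ((herm (lift y) (lift y)).re - Complex.normSq (herm (lift y) n))) /
            ((herm (lift x) (lift x)).re * (herm (lift y) (lift y)).re) := by
      rw [kappa]
      have := hxneg.ne
      have := hyneg.ne
      field_simp
      ring
    have h4 : 0 ≤ (Complex.normSq (herm (lift x) (lift y)) - (herm (lift x) (lift x)).re *
          ((herm (lift y) (lift y)).re - Complex.normSq (herm (lift y) n))) /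
            ((herm (lift x) (lift x)).re * (herm (lift y) (lift y)).re) := by
      refine div_nonneg (sub_nonneg.2 ?_) (mul_pos_of_neg_of_neg hxneg hyneg).le
      refine le_trans (le_of_eq ?_) h1
      rw [hy]
      ring
    linarith
  refine le_trans (div_le_div_of_nonneg_left hB (by linarith) (by linarith)) h2

/-- The orthogonal projection to the line. -/
noncomputable def proj (x : H2) : H2 := CHyp.proj _ (F.proj_neg x)

theorem continuous_proj : Continuous F.proj := by
  refine Continuous.proj (f := fun x => lift x - herm (lift x) n • n) ?_ F.proj_neg
  exact continuous_lift.sub ((Continuous.herm continuous_lift continuous_const).smul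
    continuous_const)

theorem proj_mem (x : H2) : F.proj x ∈ L := by
  refine F.line.symm.subset ?_
  change herm (lift (CHyp.proj _ _)) n = 0
  rw [lift_proj, herm_smul_left, herm_sub_left, herm_smul_left, F.nn]
  simp

theorem proj_point : F.proj p = p := by
  conv_rhs => rw [← proj_lift p]
  refine proj_eq _ _ 1 ?_
  rw [F.herm_line F.mem_line]
  simp

/-- The mirror image of `sinh_sq_axisDist`, with `c` and `n` exchanged. -/
theorem kappa_point_proj (x : H2) : kappa (lift p) (lift (F.proj x)) - 1 =
    Complex.normSq (herm (lift x) c) /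
      (Complex.normSq (herm (lift x) P) - Complex.normSq (herm (lift x) c)) := by
  obtain ⟨a, ha, hP⟩ := F.point
  have hw := F.proj_re x
  have h1 := ne_zero_of_neg (F.proj_neg x)
  have hneg := F.proj_neg x
  rw [hw] at hneg
  have hPw : Complex.normSq (herm P (lift x - herm (lift x) n • n)) =
      Complex.normSq (herm (lift x) P) := by
    rw [herm_sub_right, herm_smul_right, F.Pn, mul_zero, sub_zero, normSq_herm_comm]
  have h2 : kappa (lift p) (lift (F.proj x)) = kappa P (lift x - herm (lift x) n • n) := by
    have h3 : ∀ w, kappa P w = kappa (lift p) w := fun w => by rw [hP, kappa_smul_left ha]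
    rw [h3]
    change kappa (lift p) (lift (CHyp.proj _ _)) = _
    rw [lift_proj, kappa_smul_right (inv_ne_zero h1)]
  rw [h2, kappa, hPw, hw, F.PP]
  have : Complex.normSq (herm (lift x) P) - Complex.normSq (herm (lift x) c) ≠ 0 := by
    linarith
  have : Complex.normSq (herm (lift x) c) - Complex.normSq (herm (lift x) P) ≠ 0 := hneg.ne
  simp only [Complex.neg_re, Complex.one_re]
  field_simp
  ring

/-- Elements preserving the line scale its polar vector. -/
theorem exists_smul_polar {g : SU21} (hg : ∀ x ∈ L, (g : PU21)⁻¹ • x ∈ L) :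
    ∃ a : ℂ, Complex.normSq a = 1 ∧ g.1.1.mulVec n = a • n := by
  have horth : ∀ x ∈ L, herm (lift x) (g.1.1.mulVec n) = 0 := by
    intro x hx
    have h1 := F.herm_line (hg x hx)
    have h2 : x = (g : PU21) • ((g : PU21)⁻¹ • x) := (smul_inv_smul _ _).symm
    rw [h2, mk_smul, lift_proj, herm_smul_left, g.2, h1, mul_zero]
  have hP : herm P (g.1.1.mulVec n) = 0 := by
    obtain ⟨a, ha, hPa⟩ := F.point
    rw [hPa, herm_smul_left, horth p F.mem_line, mul_zero]
  have hc : herm c (g.1.1.mulVec n) = 0 := by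
    -- `2P + c` has norm `-3` and is orthogonal to `n`: a lift of a second point of the line.
    have hneg : (herm ((2 : ℂ) • P + c) ((2 : ℂ) • P + c)).re < 0 := by
      simp only [herm_add_left, herm_add_right, herm_smul_left, herm_smul_right, F.PP, F.cc, F.cP,
        F.Pc]
      norm_num
    have hmem : CHyp.proj _ hneg ∈ L := by
      rw [F.line]
      change herm (lift (CHyp.proj _ _)) n = 0
      rw [lift_proj, herm_smul_left, herm_add_left, herm_smul_left, F.Pn, F.cn]
      simp
    have h1 := horth _ hmem
    rw [lift_proj, herm_smul_left, herm_add_left, herm_smul_left, hP, mul_zero, zero_add,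
      mul_eq_zero] at h1
    exact h1.resolve_left (inv_ne_zero (ne_zero_of_neg hneg))
  have hexp := F.expand (g.1.1.mulVec n)
  rw [herm_eq_zero_comm.1 hP, herm_eq_zero_comm.1 hc, zero_smul, zero_smul, zero_add,
    sub_zero] at hexp
  refine ⟨_, ?_, hexp⟩
  have h1 := g.2 n n
  rw [hexp] at h1
  have h2 := congrArg Complex.re h1
  rw [herm_smul_self_re, F.nn] at h2
  simpa using h2

theorem proj_smul {g : PU21} (hg : ∀ x ∈ L, g⁻¹ • x ∈ L) (x : H2) :
    F.proj (g • x) = g • F.proj x := by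
  induction g using QuotientGroup.induction_on with
  | H g =>
  obtain ⟨a, ha, hga⟩ := F.exists_smul_polar hg
  set u := g.1.1.mulVec (lift x) with hu
  have hx2 := ne_zero_of_neg (F.proj_neg x)
  have hu2 : u 2 ≠ 0 := ne_zero_of_neg (mulVec_neg g x)
  have hun : herm u n • n = herm (lift x) n • g.1.1.mulVec n := by
    have h1 : herm (lift x) n = star a * herm u n := by
      rw [← g.2 (lift x) n, hga, herm_smul_right]
    have h2 : star a * a = 1 := by
      rw [mul_comm, Complex.star_def, Complex.mul_conj, ha, Complex.ofReal_one]
    rw [hga, smul_smul, h1]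
    congr 1
    linear_combination -(herm u n) * h2
  have hgx : lift ((g : PU21) • x) = (u 2)⁻¹ • u := by rw [mk_smul, lift_proj]
  have hgp : (g : PU21) • F.proj x = CHyp.proj _ (mulVec_neg g (F.proj x)) := rfl
  rw [hgp]
  refine proj_eq _ _ ((u 2)⁻¹ * (lift x - herm (lift x) n • n) 2) ?_
  have hlp : lift (F.proj x) = ((lift x - herm (lift x) n • n) 2)⁻¹ •
      (lift x - herm (lift x) n • n) := lift_proj _ _
  rw [hgx, hlp, Matrix.mulVec_smul, smul_smul, mul_assoc, mul_inv_cancel₀ hx2, mul_one,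
    herm_smul_left, Matrix.mulVec_sub, Matrix.mulVec_smul, ← hun, ← hu, smul_sub, smul_smul]

end LineFrame

/-- The triangle inequality on the common perpendicular. -/
theorem rho_le_axisDist_add {L₁ L₂ : Set H2} {p₁ p₂ : H2} {c n₁ P₁ n₂ P₂ : Fin 3 → ℂ}
    (F₁ : LineFrame L₁ p₁ c n₁ P₁) (F₂ : LineFrame L₂ p₂ c n₂ P₂) {d : ℝ} (hd : 0 ≤ d)
    (hP : P₂ = (Real.cosh (d / 2) : ℂ) • P₁ + (Real.sinh (d / 2) : ℂ) • n₁) (x : H2) :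
    d ≤ axisDist n₁ P₁ x + axisDist n₂ P₂ x := by
  have hm₁ := F₁.axis_pos x
  -- Both sides are minus the norm of the component of `lift x` orthogonal to the shared vector `c`.
  have hm : Complex.normSq (herm (lift x) P₁) - Complex.normSq (herm (lift x) n₁) =
      Complex.normSq (herm (lift x) P₂) - Complex.normSq (herm (lift x) n₂) := by
    have h1 := F₁.herm_self_re_eq (lift x)
    have h2 := F₂.herm_self_re_eq (lift x)
    linarith
  have hc₁ := F₁.cosh_sq_axisDist x
  have hs₁ := F₁.sinh_sq_axisDist x
  have hc₂ := F₂.cosh_sq_axisDist x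
  have hn₁ := axisDist_nonneg n₁ P₁ x
  have hn₂ := axisDist_nonneg n₂ P₂ x
  rw [← hm] at hc₂
  set m := Complex.normSq (herm (lift x) P₁) - Complex.normSq (herm (lift x) n₁)
  set α := axisDist n₁ P₁ x / 2 with hα
  set β := axisDist n₂ P₂ x / 2 with hβ
  have hR := Real.sq_sqrt hm₁.le
  have hRpos := Real.sqrt_pos.2 hm₁
  set R := Real.sqrt m
  have e1 : ‖herm (lift x) P₁‖ = Real.cosh α * R := by
    refine (pow_left_inj₀ (norm_nonneg _) (mul_pos (Real.cosh_pos _) hRpos).le two_ne_zero).1 ?_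
    rw [mul_pow, hc₁, hR, div_mul_cancel₀ _ hm₁.ne', Complex.normSq_eq_norm_sq]
  have e2 : ‖herm (lift x) n₁‖ = Real.sinh α * R := by
    refine (pow_left_inj₀ (norm_nonneg _)
      (mul_nonneg (Real.sinh_nonneg_iff.2 (by linarith)) hRpos.le) two_ne_zero).1 ?_
    rw [mul_pow, hs₁, hR, div_mul_cancel₀ _ hm₁.ne', Complex.normSq_eq_norm_sq]
  have e3 : ‖herm (lift x) P₂‖ = Real.cosh β * R := by
    refine (pow_left_inj₀ (norm_nonneg _) (mul_pos (Real.cosh_pos _) hRpos).le two_ne_zero).1 ?_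
    rw [mul_pow, hc₂, hR, div_mul_cancel₀ _ hm₁.ne', Complex.normSq_eq_norm_sq]
  have hlow : Real.cosh (d / 2) * ‖herm (lift x) P₁‖ - Real.sinh (d / 2) * ‖herm (lift x) n₁‖
      ≤ ‖herm (lift x) P₂‖ := by
    have h1 : herm (lift x) P₂ = (Real.cosh (d / 2) : ℂ) * herm (lift x) P₁ +
        (Real.sinh (d / 2) : ℂ) * herm (lift x) n₁ := by
      rw [hP, herm_add_right, herm_smul_right, herm_smul_right, Complex.star_def,
        Complex.conj_ofReal, Complex.conj_ofReal]
    have h2 := norm_sub_le_norm_add ((Real.cosh (d / 2) : ℂ) * herm (lift x) P₁)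
      ((Real.sinh (d / 2) : ℂ) * herm (lift x) n₁)
    rw [← h1, norm_mul, norm_mul, Complex.norm_real, Complex.norm_real, Real.norm_eq_abs,
      Real.norm_eq_abs, abs_of_pos (Real.cosh_pos _), abs_of_nonneg (Real.sinh_nonneg_iff.2 (by linarith))] at h2
    exact h2
  rw [e1, e2, e3] at hlow
  have hcosh : Real.cosh (d / 2 - α) ≤ Real.cosh β := by
    rw [Real.cosh_sub]
    refine le_of_mul_le_mul_right ?_ hRpos
    linarith
  have habs := Real.cosh_le_cosh.1 hcosh
  rw [abs_of_nonneg (by linarith : 0 ≤ β)] at habs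
  have := le_of_abs_le habs
  linarith

/-! ### The ping-pong sets -/

theorem surfProj_smul {Γ : Subgroup PU21} {L : Set H2} {g : PU21} (hg : g ∈ Γ) {z : H2}
    (hz : z ∈ L) (hgz : g • z ∈ L) : surfProj Γ L ⟨g • z, hgz⟩ = surfProj Γ L ⟨z, hz⟩ :=
  Quotient.sound (MulAction.mem_orbit z (⟨g, hg⟩ : Γ))

/-- Nontrivial elements of a `ℂ`-Fuchsian group move every point of the disc of radius the
injectivity radius out of this disc. -/
theorem IsCFuchsian.eq_one_of_lt_inj {Γ : Subgroup PU21} {L : Set H2} (h : IsCFuchsian Γ L)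
    {g : PU21} (hg : g ∈ Γ) {p z : H2} (hz : z ∈ L) (hgz : g • z ∈ L)
    (h₁ : ENNReal.ofReal (rho p z) < inj Γ L p)
    (h₂ : ENNReal.ofReal (rho p (g • z)) < inj Γ L p) : g = 1 := by
  have hmax : ENNReal.ofReal (max (rho p z) (rho p (g • z))) < inj Γ L p := by
    rw [ENNReal.ofReal_max]
    exact max_lt h₁ h₂
  rw [inj] at hmax
  obtain ⟨r, hr⟩ := lt_iSup_iff.1 hmax
  obtain ⟨hinj, hr⟩ := lt_iSup_iff.1 hr
  have hr' := (ENNReal.ofReal_lt_ofReal_iff_of_nonneg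
    ((rho_nonneg p z).trans (le_max_left _ _))).1 hr
  have hzr : rho p z < r := (le_max_left _ _).trans_lt hr'
  have hgzr : rho p (g • z) < r := (le_max_right _ _).trans_lt hr'
  have hmem : (⟨g • z, hgz⟩ : L) ∈ {x : L | rho p x < r} := hgzr
  have hmem' : (⟨z, hz⟩ : L) ∈ {x : L | rho p x < r} := hzr
  have heq : (⟨g • z, hgz⟩ : L) = ⟨z, hz⟩ := hinj hmem hmem' (surfProj_smul hg hz hgz)
  have hfix : g • z = z := congrArg Subtype.val heq
  exact h.group.eq_one_of_smul_eq hg hfix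

theorem IsCFuchsian.smul_mem {Γ : Subgroup PU21} {L : Set H2} (h : IsCFuchsian Γ L)
    {g : PU21} (hg : g ∈ Γ) {x : H2} (hx : x ∈ L) : g • x ∈ L :=
  (h.invariant g hg).subset ⟨x, hx, rfl⟩

namespace LineFrame

variable {L : Set H2} {p : H2} {c n P : Fin 3 → ℂ} (F : LineFrame L p c n P)

/-- The points whose projection to the line lies outside the disc of radius the injectivity
radius about `p`. -/
def outer (Γ : Subgroup PU21) : Set H2 :=
  {x | inj Γ L p ≤ ENNReal.ofReal (rho p (F.proj x))}

theorem isClosed_outer (Γ : Subgroup PU21) : IsClosed (F.outer Γ) :=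
  isClosed_le continuous_const
    (ENNReal.continuous_ofReal.comp (Continuous.rho continuous_const F.continuous_proj))

theorem smul_mem_outer {Γ : Subgroup PU21} (h : IsCFuchsian Γ L) {g : PU21} (hg : g ∈ Γ)
    (hg1 : g ≠ 1) {x : H2} (hx : x ∉ F.outer Γ) : g • x ∈ F.outer Γ := by
  by_contra hgx
  have hgx' : ENNReal.ofReal (rho p (F.proj (g • x))) < inj Γ L p := not_le.1 hgx
  rw [F.proj_smul fun y hy => h.smul_mem (inv_mem hg) hy] at hgx'
  exact hg1 (h.eq_one_of_lt_inj hg (F.proj_mem x) (h.smul_mem hg (F.proj_mem x))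
    (not_le.1 hx) hgx')

theorem point_notMem_outer {Γ : Subgroup PU21} (h : sFun (inj Γ L p) ≠ ⊤) : p ∉ F.outer Γ := by
  intro hp
  have h0 : inj Γ L p ≤ ENNReal.ofReal (rho p (F.proj p)) := hp
  rw [F.proj_point, rho_self, ENNReal.ofReal_zero, nonpos_iff_eq_zero] at h0
  exact h (by rw [sFun, if_pos h0])

theorem axisDist_lt_of_mem_outer {Γ : Subgroup PU21} (h : sFun (inj Γ L p) ≠ ⊤) {x : H2}
    (hx : x ∈ F.outer Γ) : axisDist n P x < (sFun (inj Γ L p)).toReal := by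
  have h0 : inj Γ L p ≠ 0 := fun h0 => h (by rw [sFun, if_pos h0])
  have hx' : inj Γ L p ≤ ENNReal.ofReal (rho p (F.proj x)) := hx
  have htop : inj Γ L p ≠ ⊤ := (hx'.trans_lt ENNReal.ofReal_lt_top).ne
  have hr : (inj Γ L p).toReal ≤ rho p (F.proj x) :=
    ENNReal.toReal_le_of_le_ofReal (rho_nonneg _ _) hx'
  have hrpos : 0 < (inj Γ L p).toReal := ENNReal.toReal_pos h0 htop
  rw [sFun, if_neg h0, if_neg htop]
  set r := (inj Γ L p).toReal
  have hS : 0 < Real.sinh (r / 2) := Real.sinh_pos_iff.2 (half_pos hrpos)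
  have hsnn : 0 ≤ 2 * Real.arsinh (1 / Real.sinh (r / 2)) :=
    mul_nonneg zero_le_two (Real.arsinh_nonneg_iff.2 (by positivity))
  rw [ENNReal.toReal_ofReal hsnn, axisDist]
  refine mul_lt_mul_of_pos_left (Real.arsinh_lt_arsinh.2 ?_) zero_lt_two
  have hk : Real.sinh (r / 2) ^ 2 ≤ Complex.normSq (herm (lift x) c) /
      (Complex.normSq (herm (lift x) P) - Complex.normSq (herm (lift x) c)) := by
    rw [← F.kappa_point_proj, ← sinh_sq_half_rho]
    exact pow_le_pow_left₀ hS.le (Real.sinh_le_sinh.2 (by linarith)) 2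
  have hlt := F.normSq_add_lt x
  have hm := F.axis_pos x
  have hA := Complex.normSq_nonneg (herm (lift x) c)
  have hB := Complex.normSq_nonneg (herm (lift x) n)
  generalize Complex.normSq (herm (lift x) c) = A at *
  generalize Complex.normSq (herm (lift x) n) = B at *
  generalize Complex.normSq (herm (lift x) P) = E at *
  generalize Real.sinh (r / 2) = S at *
  have hEA : 0 < E - A := by linarith
  rw [Real.sqrt_lt' (by positivity), div_pow, one_pow, div_lt_div_iff₀ hm (by positivity), one_mul]
  rw [le_div_iff₀ hEA] at hk
  have h1 : B * (S ^ 2 * (E - A)) ≤ B * A := mul_le_mul_of_nonneg_left hk hB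
  -- The difference is `E * (E - A - B)`, positive because the lift is negative.
  have h2 : B * A < (E - B) * (E - A) := by nlinarith
  exact lt_of_mul_lt_mul_right (by linarith : B * S ^ 2 * (E - A) < (E - B) * (E - A)) hEA.le

end LineFrame

theorem pingPong_of_frames {Γ₁ Γ₂ : Subgroup PU21} {L₁ L₂ : Set H2} (h₁ : IsCFuchsian Γ₁ L₁)
    (h₂ : IsCFuchsian Γ₂ L₂) {p₁ p₂ : H2} {c n₁ P₁ n₂ P₂ : Fin 3 → ℂ}
    (F₁ : LineFrame L₁ p₁ c n₁ P₁) (F₂ : LineFrame L₂ p₂ c n₂ P₂)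
    (hP : P₂ = (Real.cosh (rho p₁ p₂ / 2) : ℂ) • P₁ + (Real.sinh (rho p₁ p₂ / 2) : ℂ) • n₁)
    (hs₁ : sFun (inj Γ₁ L₁ p₁) ≠ ⊤) (hs₂ : sFun (inj Γ₂ L₂ p₂) ≠ ⊤)
    (hs : (sFun (inj Γ₁ L₁ p₁)).toReal + (sFun (inj Γ₂ L₂ p₂)).toReal < rho p₁ p₂) :
    PingPong (fun b => cond b Γ₁ Γ₂) (fun b => cond b L₁ L₂)
      (fun b => cond b (F₁.outer Γ₁) (F₂.outer Γ₂))
      (fun b => cond b (axisDist n₁ P₁) (axisDist n₂ P₂))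
      (fun b => cond b (sFun (inj Γ₁ L₁ p₁)).toReal (sFun (inj Γ₂ L₂ p₂)).toReal)
      (rho p₁ p₂) where
  invariant b := by
    cases b
    · exact fun g hg x hx => h₂.smul_mem hg hx
    · exact fun g hg x hx => h₁.smul_mem hg hx
  smul_mem b := by
    cases b
    · exact fun g hg hg1 x hx => F₂.smul_mem_outer h₂ hg hg1 hx
    · exact fun g hg hg1 x hx => F₁.smul_mem_outer h₁ hg hg1 hx
  closed b := by
    cases b
    · exact F₂.isClosed_outer Γ₂
    · exact F₁.isClosed_outer Γ₁
  lt_of_mem b := by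
    cases b
    · exact fun x hx => F₂.axisDist_lt_of_mem_outer hs₂ hx
    · exact fun x hx => F₁.axisDist_lt_of_mem_outer hs₁ hx
  le_add b x := by
    have := rho_le_axisDist_add F₁ F₂ (rho_nonneg p₁ p₂) hP x
    cases b
    · exact this.trans_eq (add_comm _ _)
    · exact this
  le_rho b := by
    cases b
    · exact fun x hx y => F₂.axisDist_le_rho hx y
    · exact fun x hx y => F₁.axisDist_le_rho hx y
  nonneg b := by
    cases b
    · exact ENNReal.toReal_nonneg
    · exact ENNReal.toReal_nonneg
  add_lt b := by
    cases b
    · exact (add_comm _ _).trans_lt hs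
    · exact hs
  base := by
    -- The first axis distance vanishes at `p₁`, so the second is at least the whole length, too
    -- large for the second ping-pong set.
    refine ⟨p₁, fun b => ?_⟩
    cases b
    · intro hmem
      have e1 := F₂.axisDist_lt_of_mem_outer hs₂ hmem
      have e2 := F₁.axisDist_le_rho F₁.mem_line p₁
      have e3 := rho_le_axisDist_add F₁ F₂ (rho_nonneg p₁ p₂) hP p₁
      rw [rho_self] at e2
      have e4 : 0 ≤ (sFun (inj Γ₁ L₁ p₁)).toReal := ENNReal.toReal_nonneg
      linarith
    · exact F₁.point_notMem_outer hs₁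

end CHyp

/-! ### Assembly of the theorem. -/

theorem theoremD (Γ₁ Γ₂ : Subgroup CHyp.PU21) (L₁ L₂ : Set CHyp.H2)
    (h₁ : CHyp.IsCFuchsian Γ₁ L₁) (h₂ : CHyp.IsCFuchsian Γ₂ L₂)
    (hdisj : Disjoint L₁ L₂) (p₁ p₂ : CHyp.H2)
    (hp : CHyp.IsOrthogeodesicEndpoints L₁ L₂ p₁ p₂)
    (hs : CHyp.sFun (CHyp.inj Γ₁ L₁ p₁) + CHyp.sFun (CHyp.inj Γ₂ L₂ p₂)
      < ENNReal.ofReal (CHyp.setDist CHyp.rho L₁ L₂)) :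
    CHyp.IsDiscreteTorsionFree (Γ₁ ⊔ Γ₂) ∧
    (∃ e : Monoid.Coprod Γ₁ Γ₂ ≃* ↥(Γ₁ ⊔ Γ₂),
      (∀ g : Γ₁, ((e (Monoid.Coprod.inl g) : ↥(Γ₁ ⊔ Γ₂)) : CHyp.PU21) = g) ∧
      (∀ g : Γ₂, ((e (Monoid.Coprod.inr g) : ↥(Γ₁ ⊔ Γ₂)) : CHyp.PU21) = g)) ∧
    CHyp.IsEmbeddedSurface (le_sup_left : Γ₁ ≤ Γ₁ ⊔ Γ₂) L₁ ∧
    CHyp.IsEmbeddedSurface (le_sup_right : Γ₂ ≤ Γ₁ ⊔ Γ₂) L₂ ∧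
    CHyp.setDist (CHyp.rhoQuot (Γ₁ ⊔ Γ₂))
      (Set.range (CHyp.surfMap (le_sup_left : Γ₁ ≤ Γ₁ ⊔ Γ₂) L₁))
      (Set.range (CHyp.surfMap (le_sup_right : Γ₂ ≤ Γ₁ ⊔ Γ₂) L₂))
      = CHyp.setDist CHyp.rho L₁ L₂ := by
  obtain ⟨c, n₁, P₁, n₂, P₂, G₁, G₂, hL₁, hL₂, hp₁, hp₂, hP⟩ := hp.exists_frames h₁.line h₂.line
  have F₁ : CHyp.LineFrame L₁ p₁ c n₁ P₁ := ⟨G₁, hL₁, hp₁⟩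
  have F₂ : CHyp.LineFrame L₂ p₂ c n₂ P₂ := ⟨G₂, hL₂, hp₂⟩
  -- Finiteness of the sum excludes the default value `⊤` of `sFun`, so both injectivity radii are
  -- nonzero.
  have hsum := (hs.trans ENNReal.ofReal_lt_top).ne
  have hs₁ := (ENNReal.add_ne_top.1 hsum).1
  have hs₂ := (ENNReal.add_ne_top.1 hsum).2
  have hd : CHyp.setDist CHyp.rho L₁ L₂ ≤ CHyp.rho p₁ p₂ := by
    refine csInf_le ⟨0, ?_⟩ ⟨p₁, F₁.mem_line, p₂, F₂.mem_line, rfl⟩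
    rintro _ ⟨x, -, y, -, rfl⟩
    exact CHyp.rho_nonneg x y
  have hs' : (CHyp.sFun (CHyp.inj Γ₁ L₁ p₁)).toReal + (CHyp.sFun (CHyp.inj Γ₂ L₂ p₂)).toReal
      < CHyp.rho p₁ p₂ := by
    rw [← ENNReal.toReal_add hs₁ hs₂]
    exact ((ENNReal.lt_ofReal_iff_toReal_lt hsum).1 hs).trans_le hd
  have P := CHyp.pingPong_of_frames h₁ h₂ F₁ F₂ hP hs₁ hs₂ hs'
  refine ⟨P.isDiscreteTorsionFree fun b => ?_, P.exists_coprod_equiv, ?_, ?_,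
    P.setDist_rhoQuot (fun b => ?_) hd rfl _ _⟩
  · cases b
    · exact h₂.group.torsionFree
    · exact h₁.group.torsionFree
  · exact CHyp.isEmbeddedSurface_of_separated _ h₁.line ⟨p₁, F₁.mem_line⟩
      (fun g hg x hx => h₁.smul_mem hg hx) (sub_pos.2 (P.add_lt true))
      fun g hg hg1 x hx y hy => P.separated_same true hg hg1 hx hy
  · exact CHyp.isEmbeddedSurface_of_separated _ h₂.line ⟨p₂, F₂.mem_line⟩
      (fun g hg x hx => h₂.smul_mem hg hx) (sub_pos.2 (P.add_lt false))
      fun g hg hg1 x hx y hy => P.separated_same false hg hg1 hx hy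
  · cases b
    · exact ⟨p₂, F₂.mem_line⟩
    · exact ⟨p₁, F₁.mem_line⟩
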